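/- Let $0<\delta<W$ and, for $n\in\mathbb Z$, let $t_n^{\pm}:=W\pm(-1)^n\delta$. For a bounded real sequence $a=(a_n)_{n\in\mathbb Z}$ let the corresponding capital letter $A$ denote the bounded self-adjoint operator on $\ell^2(\mathbb Z,\mathbb C)$ given by $(A\psi)_n=a_{n-1}\psi_{n-1}+a_n\psi_{n+1}$, that is, $A_{n,n+1}=A_{n+1,n}=a_n$ and all other matrix entries vanish. For a bounded self-adjoint operator $A$ write $A_-:=-A\,\mathbf 1(A<0)$. A real sequence $t$ is called homoclinic if $|t_n-t_n^+|\to0$ as $n\to-\infty$ and as $n\to+\infty$, and heteroclinic if $|t_n-t_n^-|\to0$ as $n\to-\infty$ and $|t_n-t_n^+|\to0$ as $n\to+\infty$ (such sequences are bounded). Let $t$ be homoclinic or heteroclinic with $t_n\ge\tau$ for all $n\in\mathbb Z$, for some $\tau>0$. Then $g:=\operatorname{dist}(0,\sigma(T)\setminus\{0\})>0$, and there are a number $\Sigma<-g/2$, a constant $C\ge0$ and a constant $\eta>0$ (all depending on $t$) such that, with $\mathscr C$ the positively oriented rectangular contour $$(\Sigma+i)\to(\Sigma-i)\to(-g/2-i)\to(-g/2+i)\to(\Sigma+i),$$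 the following holds for every bounded real sequence $h$ with $\|h\|_{\ell^\infty}\le\eta$: 1. for all $z\in\mathscr C$ the operator $z-(T+H)$ is invertible, with $\|(z-(T+H))^{-1}\|_{\rm op}\le C$; 2. $\displaystyle -(T+H)_-=\frac1{2\pi i}\oint_{\mathscr C} z\,(z-(T+H))^{-1}\,dz$; 3. if $t$ is homoclinic, then $0\notin\sigma(T+H)$; 4. if $t$ is heteroclinic, then $0$ is an eigenvalue of $T+H$ of multiplicity $1$ and an isolated point of $\sigma(T+H)$. -/

import Mathlib

open scoped ENNReal

noncomputable section

namespace SSH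

/-- The Hilbert space `ℓ²(ℤ, ℂ)`. -/
abbrev Hil : Type := lp (fun _ : ℤ => ℂ) 2

/-- Bounded real sequences `ℓ^∞(ℤ, ℝ)`, with the supremum norm. -/
abbrev Seq : Type := lp (fun _ : ℤ => ℝ) ∞

/-- The dimerized configuration `t⁺_n = W + (-1)^n δ`. -/
def dimerPlus (W δ : ℝ) (n : ℤ) : ℝ := W + (-1 : ℝ) ^ n * δ

/-- The dimerized configuration `t⁻_n = W - (-1)^n δ`. -/
def dimerMinus (W δ : ℝ) (n : ℤ) : ℝ := W - (-1 : ℝ) ^ n * δ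

/-- `t` converges to `t⁺` both at `-∞` and at `+∞`. -/
def IsHomoclinic (W δ : ℝ) (t : ℤ → ℝ) : Prop :=
  Filter.Tendsto (fun n => |t n - dimerPlus W δ n|) Filter.atBot (nhds 0) ∧
    Filter.Tendsto (fun n => |t n - dimerPlus W δ n|) Filter.atTop (nhds 0)

/-- `t` converges to `t⁻` at `-∞` and to `t⁺` at `+∞`. -/
def IsHeteroclinic (W δ : ℝ) (t : ℤ → ℝ) : Prop :=
  Filter.Tendsto (fun n => |t n - dimerMinus W δ n|) Filter.atBot (nhds 0) ∧
    Filter.Tendsto (fun n => |t n - dimerPlus W δ n|) Filter.atTop (nhds 0)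

theorem memℓp_mul_comp (a : Seq) (e f : ℤ ≃ ℤ) (ψ : Hil) :
    Memℓp (fun n => ((a (e n) : ℝ) : ℂ) * ψ (f n)) 2 := by
  have h2 : (0 : ℝ) < (2 : ℝ≥0∞).toReal := by norm_num
  rw [memℓp_gen_iff h2]
  have hs := (f.summable_iff.mpr ((memℓp_gen_iff h2).mp (lp.memℓp ψ))).mul_left (‖a‖ ^ 2)
  refine Summable.of_nonneg_of_le (fun n => by positivity) (fun n => ?_) hs
  have ha : ‖a (e n)‖ ≤ ‖a‖ := lp.norm_apply_le_norm (by simp) a (e n)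
  simp only [norm_mul, Complex.norm_real, ENNReal.toReal_ofNat, Real.rpow_ofNat, mul_pow,
    Function.comp_apply]
  gcongr

theorem norm_mul_comp_le (a : Seq) (e f : ℤ ≃ ℤ) (ψ : Hil) :
    ‖(⟨_, memℓp_mul_comp a e f ψ⟩ : Hil)‖ ≤ ‖a‖ * ‖ψ‖ := by
  have h2 : (0 : ℝ) < (2 : ℝ≥0∞).toReal := by norm_num
  refine lp.norm_le_of_tsum_le h2 (by positivity) ?_
  have hs := (f.summable_iff.mpr ((memℓp_gen_iff h2).mp (lp.memℓp ψ))).mul_left (‖a‖ ^ 2)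
  have hle := Summable.tsum_le_tsum (fun n => ?_)
    ((memℓp_gen_iff h2).mp (memℓp_mul_comp a e f ψ)) hs
  · refine hle.trans (le_of_eq ?_)
    rw [tsum_mul_left, Real.mul_rpow (norm_nonneg _) (norm_nonneg _), lp.norm_rpow_eq_tsum h2]
    congr 1
    · simp
    · exact f.tsum_eq (fun n => ‖ψ n‖ ^ (2 : ℝ≥0∞).toReal)
  · have ha : ‖a (e n)‖ ≤ ‖a‖ := lp.norm_apply_le_norm (by simp) a (e n)
    simp only [norm_mul, Complex.norm_real, ENNReal.toReal_ofNat, Real.rpow_ofNat, mul_pow,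
      Function.comp_apply]
    gcongr

/-- The operator on `ℓ²(ℤ, ℂ)` with matrix entries `A_{n,n+1} = A_{n+1,n} = a_n`, all others `0`:
`(A ψ)_n = a_{n-1} ψ_{n-1} + a_n ψ_{n+1}`. -/
def hop (a : Seq) : Hil →L[ℂ] Hil :=
  LinearMap.mkContinuous
    { toFun := fun ψ =>
        ⟨fun n => ((a (n - 1) : ℝ) : ℂ) * ψ (n - 1) + ((a n : ℝ) : ℂ) * ψ (n + 1),
          (memℓp_mul_comp a (Equiv.subRight 1) (Equiv.subRight 1) ψ).add
            (memℓp_mul_comp a (Equiv.refl ℤ) (Equiv.addRight 1) ψ)⟩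
      map_add' := fun φ ψ => by
        ext n
        simp only [lp.coeFn_add, Pi.add_apply]
        ring
      map_smul' := fun c ψ => by
        ext n
        simp only [lp.coeFn_smul, Pi.smul_apply, smul_eq_mul, RingHom.id_apply]
        ring }
    (2 * ‖a‖)
    (fun ψ => by
      have h1 := norm_mul_comp_le a (Equiv.subRight 1) (Equiv.subRight 1) ψ
      have h2 := norm_mul_comp_le a (Equiv.refl ℤ) (Equiv.addRight 1) ψ
      refine (norm_add_le (⟨_, memℓp_mul_comp a (Equiv.subRight 1) (Equiv.subRight 1) ψ⟩ : Hil)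
        ⟨_, memℓp_mul_comp a (Equiv.refl ℤ) (Equiv.addRight 1) ψ⟩).trans ?_
      linarith)

theorem hop_apply (a : Seq) (ψ : Hil) (n : ℤ) :
    hop a ψ n = ((a (n - 1) : ℝ) : ℂ) * ψ (n - 1) + ((a n : ℝ) : ℂ) * ψ (n + 1) := rfl

/-- `hop a` is self-adjoint, so that its negative part, taken by the continuous functional
calculus, is the usual one. -/
theorem isSelfAdjoint_hop (a : Seq) : IsSelfAdjoint (hop a) := by
  rw [ContinuousLinearMap.isSelfAdjoint_iff_isSymmetric]
  intro φ ψ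
  have s1 := lp.summable_inner (𝕜 := ℂ) φ
    (⟨_, memℓp_mul_comp a (Equiv.subRight 1) (Equiv.subRight 1) ψ⟩ : Hil)
  have s2 := lp.summable_inner (𝕜 := ℂ) φ
    (⟨_, memℓp_mul_comp a (Equiv.refl ℤ) (Equiv.addRight 1) ψ⟩ : Hil)
  have s3 := lp.summable_inner (𝕜 := ℂ)
    (⟨_, memℓp_mul_comp a (Equiv.subRight 1) (Equiv.subRight 1) φ⟩ : Hil) ψ
  have s4 := lp.summable_inner (𝕜 := ℂ)
    (⟨_, memℓp_mul_comp a (Equiv.refl ℤ) (Equiv.addRight 1) φ⟩ : Hil) ψ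
  have e1 : inner ℂ (hop a φ) ψ = _ := (lp.inner_eq_tsum (hop a φ) ψ).trans
    ((tsum_congr fun n => inner_add_left _ _ _).trans (s3.tsum_add s4))
  have e2 : inner ℂ φ (hop a ψ) = _ := (lp.inner_eq_tsum φ (hop a ψ)).trans
    ((tsum_congr fun n => inner_add_right _ _ _).trans (s1.tsum_add s2))
  refine e1.trans (Eq.trans ?_ e2.symm)
  rw [add_comm]
  congr 1
  · rw [← (Equiv.subRight (1 : ℤ)).tsum_eq]
    refine tsum_congr fun n => ?_
    simp [mul_assoc, mul_left_comm]
  · rw [← (Equiv.addRight (1 : ℤ)).tsum_eq]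
    refine tsum_congr fun n => ?_
    simp [mul_assoc, mul_left_comm]

section General

variable {E : Type*} [NormedAddCommGroup E] [InnerProductSpace ℂ E] [CompleteSpace E]

/-- The negative part `A_- = -A 𝟙(A < 0)` of a self-adjoint bounded operator, i.e. the function
`x ↦ max (-x) 0` of `A` in the continuous functional calculus. -/
def negativePart (A : E →L[ℂ] E) : E →L[ℂ] E := A⁻

/-- The distance `g = dist(0, σ(A) \ {0})`. -/
def gap (A : E →L[ℂ] E) : ℝ := Metric.infDist 0 (spectrum ℂ A \ {0})

/-- The complex line integral `∫_γ f(z) dz` of an operator-valued function: the curve integral of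
the one-form `v ↦ v • f z`. -/
def lineIntegral {p q : ℂ} (γ : Path p q) (f : ℂ → (E →L[ℂ] E)) : E →L[ℂ] E :=
  curveIntegral (fun z : ℂ => ContinuousLinearMap.toSpanSingleton ℂ (f z)) γ

/-- `μ` is an eigenvalue of `A` of multiplicity one, and an isolated point of the spectrum. -/
def IsSimpleIsolatedEigenvalue (A : E →L[ℂ] E) (μ : ℂ) : Prop :=
  Module.End.HasEigenvalue (A : E →ₗ[ℂ] E) μ ∧
    Module.finrank ℂ (Module.End.eigenspace (A : E →ₗ[ℂ] E) μ) = 1 ∧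
    ∃ ε > 0, spectrum ℂ A ∩ Metric.ball μ ε = {μ}

end General

/-- The closed rectangular path
`(l + i) → (l - i) → (r - i) → (r + i) → (l + i)`,
positively oriented (counterclockwise) if `l < r`. -/
def contour (l r : ℝ) : Path ((l : ℂ) + Complex.I) ((l : ℂ) + Complex.I) :=
  (Path.segment ((l : ℂ) + Complex.I) ((l : ℂ) - Complex.I)).trans
    ((Path.segment ((l : ℂ) - Complex.I) ((r : ℂ) - Complex.I)).trans
      ((Path.segment ((r : ℂ) - Complex.I) ((r : ℂ) + Complex.I)).trans
        (Path.segment ((r : ℂ) + Complex.I) ((l : ℂ) + Complex.I))))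

end SSH

end

/-!
The operator `hop a` exchanges the even and the odd sublattice. When, near infinity, the bonds of
one parity dominate those of the other by a fixed ratio, the one-step equation
`(A ψ)_n = a_{n-1} ψ_{n-1} + a_n ψ_{n+1}` bounds the components of `ψ` on one sublattice
geometrically, hence `c ‖ψ‖ ≤ ‖A ψ‖` for all `ψ` living on that sublattice. Such a lower bound
survives small perturbations of the operator. Since `A` is chiral, a lower bound on one sublattice
already keeps the nonzero spectrum at distance at least `c` from `0`; bounds on both sublattices
make `A` invertible. In the heteroclinic case the dominance changes parity between the two ends, so
the solution of `A ψ = 0` on the odd sublattice decays at both of them and spans the kernel.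

The contour encloses the negative spectrum of `A` and no other spectral point, so the integral
formula is Cauchy's formula applied under the continuous functional calculus.
-/

noncomputable section

namespace SSH

open Set MeasureTheory Filter Topology

/-! ### Cauchy integrals along segments -/

section Segment

variable {p q x : ℂ}

theorem div_sub_mem_slitPlane {z : ℂ} (hx : x ∉ segment ℝ p q) (hz : z ∈ segment ℝ p q) :
    (z - x) / (p - x) ∈ Complex.slitPlane := by
  have hp : p - x ≠ 0 := fun h => hx (sub_eq_zero.mp h ▸ left_mem_segment ℝ p q)
  by_contra hs
  rw [Complex.mem_slitPlane_iff_not_le_zero, not_not, Complex.le_def] at hs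
  set w := (z - x) / (p - x) with hw
  have hzx : z - x = (-w.re) • (x - p) := by
    have hre : ((w.re : ℝ) : ℂ) = w := Complex.ext rfl hs.2.symm
    rw [Complex.real_smul, Complex.ofReal_neg, hre, hw]
    field_simp
    ring
  refine hx ((convex_segment p q).segment_subset (left_mem_segment ℝ p q) hz
    (mem_segment_iff_sameRay.mpr ?_))
  rw [hzx]
  exact SameRay.sameRay_nonneg_smul_right _ (neg_nonneg.mpr hs.1)

theorem continuousOn_inv_lineMap_sub (hx : x ∉ segment ℝ p q) :
    ContinuousOn (fun s : ℝ => (AffineMap.lineMap p q s - x : ℂ)⁻¹) (Icc 0 1) := by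
  refine ContinuousOn.inv₀ (AffineMap.lineMap_continuous.continuousOn.sub continuousOn_const)
    fun s hs h0 => hx ?_
  rw [← sub_eq_zero.mp h0]
  exact lineMap_mem_segment ℝ p q hs

theorem integral_inv_lineMap_sub_eq_log {c : ℂ}
    (h : ∀ z ∈ segment ℝ p q, c * (z - x) ∈ Complex.slitPlane) :
    ∫ s in (0 : ℝ)..1, (q - p) * (AffineMap.lineMap p q s - x : ℂ)⁻¹ =
      Complex.log (c * (q - x)) - Complex.log (c * (p - x)) := by
  have hx : x ∉ segment ℝ p q := fun hx => Complex.slitPlane_ne_zero (h x hx) (by simp)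
  have hderiv : ∀ s ∈ uIcc (0 : ℝ) 1, HasDerivAt
      (fun s : ℝ => Complex.log (c * (AffineMap.lineMap p q s - x)))
      ((q - p) * (AffineMap.lineMap p q s - x)⁻¹) s := fun s hs => by
    rw [uIcc_of_le zero_le_one] at hs
    have hmem := h _ (lineMap_mem_segment ℝ p q hs)
    obtain ⟨hc, hsx⟩ := mul_ne_zero_iff.mp (Complex.slitPlane_ne_zero hmem)
    convert ((AffineMap.hasDerivAt_lineMap.sub_const x).const_mul c).clog_real hmem using 1
    field_simp
  rw [intervalIntegral.integral_eq_sub_of_hasDerivAt hderiv (ContinuousOn.intervalIntegrable_of_Icc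
    zero_le_one (continuousOn_const.mul (continuousOn_inv_lineMap_sub hx)))]
  simp

/-- The increment of `z ↦ log (z - x)` along the segment from `p` to `q`. Taking the logarithm of
the quotient makes the principal branch correct as soon as `x` is off the segment. -/
def logIncrement (p q x : ℂ) : ℂ := Complex.log ((q - x) / (p - x))

theorem integral_inv_lineMap_sub (hx : x ∉ segment ℝ p q) :
    ∫ s in (0 : ℝ)..1, (q - p) * (AffineMap.lineMap p q s - x : ℂ)⁻¹ =
      logIncrement p q x := by
  have hp : p - x ≠ 0 := fun h => hx (sub_eq_zero.mp h ▸ left_mem_segment ℝ p q)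
  have hslit : ∀ z ∈ segment ℝ p q, (p - x)⁻¹ * (z - x) ∈ Complex.slitPlane := fun z hz => by
    rw [inv_mul_eq_div]
    exact div_sub_mem_slitPlane hx hz
  rw [integral_inv_lineMap_sub_eq_log hslit, inv_mul_cancel₀ hp, Complex.log_one, sub_zero,
    inv_mul_eq_div, logIncrement]

theorem logIncrement_eq_log_sub_log {c : ℂ}
    (h : ∀ z ∈ segment ℝ p q, c * (z - x) ∈ Complex.slitPlane) :
    logIncrement p q x = Complex.log (c * (q - x)) - Complex.log (c * (p - x)) := by
  have hx : x ∉ segment ℝ p q := fun hx => Complex.slitPlane_ne_zero (h x hx) (by simp)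
  rw [← integral_inv_lineMap_sub hx, integral_inv_lineMap_sub_eq_log h]

/-- The integrand `f(z) / (z - x) dz` of a Cauchy integral, pulled back to `[0, 1]` by the affine
parametrization of the segment from `p` to `q`. -/
def cauchyKernel (f : ℂ → ℂ) (p q : ℂ) (s : ℝ) (x : ℂ) : ℂ :=
  (q - p) * (f (AffineMap.lineMap p q s) * (AffineMap.lineMap p q s - x)⁻¹)

theorem integral_cauchyKernel_id (hx : x ∉ segment ℝ p q) :
    ∫ s in (0 : ℝ)..1, cauchyKernel id p q s x = (q - p) + x * logIncrement p q x := by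
  have hsplit : ∀ s ∈ uIcc (0 : ℝ) 1, cauchyKernel id p q s x =
      (q - p) + x * ((q - p) * (AffineMap.lineMap p q s - x : ℂ)⁻¹) := fun s hs => by
    rw [uIcc_of_le zero_le_one] at hs
    have h0 : (AffineMap.lineMap p q s - x : ℂ) ≠ 0 := fun h0 =>
      hx (sub_eq_zero.mp h0 ▸ lineMap_mem_segment ℝ p q hs)
    rw [cauchyKernel, id_eq]
    field_simp
    ring
  have hint : IntervalIntegrable (fun s : ℝ => x * ((q - p) * (AffineMap.lineMap p q s - x)⁻¹))
      volume 0 1 := ContinuousOn.intervalIntegrable_of_Icc zero_le_one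
    (continuousOn_const.mul (continuousOn_const.mul (continuousOn_inv_lineMap_sub hx)))
  rw [intervalIntegral.integral_congr hsplit, intervalIntegral.integral_add (by simp) hint,
    intervalIntegral.integral_const_mul, integral_inv_lineMap_sub hx]
  simp

theorem continuousOn_logIncrement {S : Set ℂ} (hS : ∀ x ∈ S, x ∉ segment ℝ p q) :
    ContinuousOn (logIncrement p q) S := by
  refine ContinuousOn.clog (ContinuousOn.div (by fun_prop) (by fun_prop) fun x hx h => ?_)
    fun x hx => div_sub_mem_slitPlane (hS x hx) (right_mem_segment ℝ p q)
  exact hS x hx (sub_eq_zero.mp h ▸ left_mem_segment ℝ p q)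

theorem continuousOn_cauchyKernel {f : ℂ → ℂ} (hf : ContinuousOn f (segment ℝ p q)) {S : Set ℂ}
    (hS : ∀ x ∈ S, x ∉ segment ℝ p q) :
    ContinuousOn (Function.uncurry (cauchyKernel f p q)) (Icc 0 1 ×ˢ S) := by
  have hline : Continuous fun y : ℝ × ℂ => (AffineMap.lineMap p q y.1 : ℂ) :=
    AffineMap.lineMap_continuous.comp continuous_fst
  refine continuousOn_const.mul ((hf.comp hline.continuousOn fun y hy =>
    lineMap_mem_segment ℝ p q hy.1).mul (ContinuousOn.inv₀
      (hline.sub continuous_snd).continuousOn fun y hy h0 => hS y.2 hy.2 ?_))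
  rw [← sub_eq_zero.mp h0]
  exact lineMap_mem_segment ℝ p q hy.1

end Segment

/-! ### Resolvents of normal elements -/

section Resolvent

variable {A : Type*} [CStarAlgebra A] {B : A} [IsStarNormal B] {z : ℂ}

theorem resolvent_eq_cfc (hz : z ∉ spectrum ℂ B) :
    resolvent B z = cfc (fun x : ℂ => (z - x)⁻¹) B := by
  have hne : ∀ x ∈ spectrum ℂ B, z - x ≠ 0 := fun x hx h => hz (sub_eq_zero.mp h ▸ hx)
  rw [cfc_inv (fun x : ℂ => z - x) B hne, cfc_sub (fun _ => z) (fun x => x) B,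
    cfc_const z B, cfc_id' ℂ B]
  rfl

theorem norm_resolvent_le {d : ℝ} (hd : 0 < d) (h : ∀ x ∈ spectrum ℂ B, d ≤ ‖z - x‖) :
    ‖resolvent B z‖ ≤ d⁻¹ := by
  have hz : z ∉ spectrum ℂ B := fun hz => by simpa using hd.trans_le (h z hz)
  rw [resolvent_eq_cfc hz]
  refine norm_cfc_le (by positivity) fun x hx => ?_
  rw [norm_inv]
  exact inv_anti₀ hd (h x hx)

theorem exists_mem_spectrum_norm_sub_lt {H : A} {d : ℝ} (hH : ‖H‖ < d)
    (hz : z ∈ spectrum ℂ (B + H)) : ∃ x ∈ spectrum ℂ B, ‖z - x‖ < d := by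
  by_contra! h
  have hd : 0 < d := (norm_nonneg H).trans_lt hH
  have hzB : z ∉ spectrum ℂ B := fun hz => by simpa using hd.trans_le (h z hz)
  have hu : IsUnit (algebraMap ℂ A z - B) := spectrum.notMem_iff.mp hzB
  have hRH : ‖resolvent B z * H‖ < 1 := by
    calc ‖resolvent B z * H‖ ≤ ‖resolvent B z‖ * ‖H‖ := norm_mul_le _ _
      _ ≤ d⁻¹ * ‖H‖ := by gcongr; exact norm_resolvent_le hd h
      _ < d⁻¹ * d := by gcongr
      _ = 1 := inv_mul_cancel₀ hd.ne'
  refine spectrum.notMem_iff.mpr ?_ hz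
  have hfactor : algebraMap ℂ A z - (B + H) = (algebraMap ℂ A z - B) * (1 - resolvent B z * H) := by
    rw [mul_sub, mul_one, ← mul_assoc, resolvent, Ring.mul_inverse_cancel _ hu, one_mul,
      sub_add_eq_sub_sub]
  exact hfactor ▸ hu.mul (isUnit_one_sub_of_norm_lt_one hRH)

end Resolvent

section ContourIntegral

variable {E : Type*} [NormedAddCommGroup E] [InnerProductSpace ℂ E] [CompleteSpace E]

theorem toSpanSingleton_resolvent_eq_cfc {B : E →L[ℂ] E} [IsStarNormal B] (f : ℂ → ℂ) {p q : ℂ}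
    (hB : ∀ x ∈ spectrum ℂ B, x ∉ segment ℝ p q) {s : ℝ} (hs : s ∈ Icc (0 : ℝ) 1) :
    ContinuousLinearMap.toSpanSingleton ℂ
      (f (AffineMap.lineMap p q s) • resolvent B (AffineMap.lineMap p q s : ℂ)) (q - p) =
      cfc (cauchyKernel f p q s) B := by
  have hz : (AffineMap.lineMap p q s : ℂ) ∉ spectrum ℂ B :=
    fun hz => hB _ hz (lineMap_mem_segment ℝ p q hs)
  have hc : ContinuousOn (fun x => (AffineMap.lineMap p q s - x : ℂ)⁻¹) (spectrum ℂ B) :=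
    ContinuousOn.inv₀ (by fun_prop) fun x hx h0 => hz (sub_eq_zero.mp h0 ▸ hx)
  rw [ContinuousLinearMap.toSpanSingleton_apply, resolvent_eq_cfc hz,
    ← cfc_const_mul _ _ B hc, ← cfc_const_mul _ _ B (hc.const_mul _)]
  rfl

theorem curveIntegrable_segment_smul_resolvent {B : E →L[ℂ] E} [IsStarNormal B] {f : ℂ → ℂ}
    {p q : ℂ} (hf : ContinuousOn f (segment ℝ p q))
    (hB : ∀ x ∈ spectrum ℂ B, x ∉ segment ℝ p q) :
    CurveIntegrable (fun z : ℂ => ContinuousLinearMap.toSpanSingleton ℂ (f z • resolvent B z))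
      (Path.segment p q) := by
  have hker := continuousOn_cauchyKernel hf hB
  obtain ⟨M, hM⟩ := (isCompact_Icc.prod (spectrum.isCompact B)).exists_bound_of_continuousOn hker
  rw [curveIntegrable_segment, intervalIntegrable_iff_integrableOn_Icc_of_le zero_le_one]
  exact (integrableOn_cfc (μ := volume) measurableSet_Icc _ (fun _ => M) B hker
    (ae_restrict_of_forall_mem measurableSet_Icc fun s hs x hx => hM (s, x) ⟨hs, hx⟩)
    (integrable_const M).hasFiniteIntegral).congr_fun
    (fun s hs => (toSpanSingleton_resolvent_eq_cfc f hB hs).symm) measurableSet_Icc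

theorem lineIntegral_segment_smul_resolvent {B : E →L[ℂ] E} [IsStarNormal B] {f : ℂ → ℂ} {p q : ℂ}
    (hf : ContinuousOn f (segment ℝ p q)) (hB : ∀ x ∈ spectrum ℂ B, x ∉ segment ℝ p q) :
    lineIntegral (Path.segment p q) (fun z => f z • resolvent B z) =
      cfc (fun x => ∫ s in (0 : ℝ)..1, cauchyKernel f p q s x) B := by
  have hker := continuousOn_cauchyKernel hf hB
  obtain ⟨M, hM⟩ := (isCompact_Icc.prod (spectrum.isCompact B)).exists_bound_of_continuousOn hker
  simp only [lineIntegral, curveIntegral_segment, intervalIntegral.integral_of_le zero_le_one,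
    ← integral_Icc_eq_integral_Ioc]
  rw [setIntegral_congr_fun measurableSet_Icc
      (fun s hs => toSpanSingleton_resolvent_eq_cfc f hB hs)]
  exact (cfc_setIntegral (μ := volume) measurableSet_Icc _ (fun _ => M) B hker
    (ae_restrict_of_forall_mem measurableSet_Icc fun s hs x hx => hM (s, x) ⟨hs, hx⟩)
    (integrable_const M).hasFiniteIntegral).symm

end ContourIntegral

/-! ### The rectangular contour -/

section Rectangle

variable {l r : ℝ} {z : ℂ}

theorem range_contour (l r : ℝ) :
    range (contour l r) =
      segment ℝ ((l : ℂ) + Complex.I) ((l : ℂ) - Complex.I) ∪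
      (segment ℝ ((l : ℂ) - Complex.I) ((r : ℂ) - Complex.I) ∪
      (segment ℝ ((r : ℂ) - Complex.I) ((r : ℂ) + Complex.I) ∪
      segment ℝ ((r : ℂ) + Complex.I) ((l : ℂ) + Complex.I))) := by
  simp only [contour, Path.trans_range, Path.range_segment]

theorem re_eq_of_mem_segment {p q : ℂ} (hpq : p.re = q.re) (hz : z ∈ segment ℝ p q) :
    z.re = q.re := by
  obtain ⟨s, u, -, -, hsu, rfl⟩ := hz
  simp [hpq, ← add_mul, hsu]

theorem im_eq_of_mem_segment {p q : ℂ} (hpq : p.im = q.im) (hz : z ∈ segment ℝ p q) :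
    z.im = q.im := by
  obtain ⟨s, u, -, -, hsu, rfl⟩ := hz
  simp [hpq, ← add_mul, hsu]

theorem re_eq_or_abs_im_eq_of_mem_range_contour (hz : z ∈ range (contour l r)) :
    z.re = l ∨ z.re = r ∨ |z.im| = 1 := by
  rw [range_contour] at hz
  rcases hz with hz | hz | hz | hz
  · left; simpa using re_eq_of_mem_segment (by simp) hz
  · right; right; simp [im_eq_of_mem_segment (by simp) hz]
  · right; left; simpa using re_eq_of_mem_segment (by simp) hz
  · right; right; simp [im_eq_of_mem_segment (by simp) hz]

theorem min_le_norm_sub_ofReal_of_mem_range_contour (hz : z ∈ range (contour l r)) (x : ℝ) :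
    min (min |l - x| |r - x|) 1 ≤ ‖z - x‖ := by
  have hre : |z.re - x| ≤ ‖z - x‖ := by simpa using Complex.abs_re_le_norm (z - x)
  have him : |z.im| ≤ ‖z - x‖ := by simpa using Complex.abs_im_le_norm (z - x)
  rcases re_eq_or_abs_im_eq_of_mem_range_contour hz with h | h | h
  · exact (min_le_left _ _).trans ((min_le_left _ _).trans (h ▸ hre))
  · exact (min_le_left _ _).trans ((min_le_right _ _).trans (h ▸ hre))
  · exact (min_le_right _ _).trans (h ▸ him)

theorem ofReal_notMem_range_contour {x : ℝ} (hl : l ≠ x) (hr : r ≠ x) :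
    (x : ℂ) ∉ range (contour l r) := fun hx => by
  have hpos : 0 < min (min |l - x| |r - x|) 1 :=
    lt_min (lt_min (abs_sub_pos.mpr hl) (abs_sub_pos.mpr hr)) one_pos
  simpa using hpos.trans_le (min_le_norm_sub_ofReal_of_mem_range_contour hx x)

/-- The increment of `z ↦ log (z - x)` along `contour l r`, that is, `2πi` times the winding number
of the contour around `x`. -/
def contourLogIncrement (l r : ℝ) (x : ℂ) : ℂ :=
  logIncrement (l + Complex.I) (l - Complex.I) x + (logIncrement (l - Complex.I) (r - Complex.I) x +
    (logIncrement (r - Complex.I) (r + Complex.I) x +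
      logIncrement (r + Complex.I) (l + Complex.I) x))

theorem contourLogIncrement_of_lt {x : ℝ} (hl : l < x) (hr : r < x) :
    contourLogIncrement l r x = 0 := by
  have hlog : ∀ p q : ℂ, p.re < x → q.re < x → logIncrement p q x =
      Complex.log (-1 * (q - x)) - Complex.log (-1 * (p - x)) := fun p q hp hq =>
    logIncrement_eq_log_sub_log fun z hz => Or.inl <| by
      have hzx : z.re < x := (convex_halfSpace_re_lt x).segment_subset hp hq hz
      simpa using hzx
  simp only [contourLogIncrement]
  rw [hlog _ _ (by simpa) (by simpa), hlog _ _ (by simpa) (by simpa),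
    hlog _ _ (by simpa) (by simpa), hlog _ _ (by simpa) (by simpa)]
  ring

theorem log_neg_of_im_neg (hz : z.im < 0) :
    Complex.log (-z) = Complex.log z + Real.pi * Complex.I := by
  rw [Complex.log, Complex.log, norm_neg, Complex.arg_neg_eq_arg_add_pi_of_im_neg hz]
  push_cast
  ring

theorem log_neg_of_im_pos (hz : 0 < z.im) :
    Complex.log (-z) = Complex.log z - Real.pi * Complex.I := by
  rw [Complex.log, Complex.log, norm_neg, Complex.arg_neg_eq_arg_sub_pi_of_im_pos hz]
  push_cast
  ring

theorem contourLogIncrement_of_mem_Ioo {x : ℝ} (hx : x ∈ Ioo l r) :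
    contourLogIncrement l r x = 2 * Real.pi * Complex.I := by
  -- Only the left side of the rectangle crosses the branch cut of `z ↦ log (z - x)`.
  have hleft : logIncrement (l + Complex.I) (l - Complex.I) x =
      Complex.log (-1 * (l - Complex.I - x)) - Complex.log (-1 * (l + Complex.I - x)) :=
    logIncrement_eq_log_sub_log fun z hz => Or.inl <| by
      simp [re_eq_of_mem_segment (by simp) hz, hx.1]
  have hbottom : logIncrement (l - Complex.I) (r - Complex.I) x =
      Complex.log (1 * (r - Complex.I - x)) - Complex.log (1 * (l - Complex.I - x)) :=
    logIncrement_eq_log_sub_log fun z hz => Or.inr <| by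
      simp [im_eq_of_mem_segment (by simp) hz]
  have hright : logIncrement (r - Complex.I) (r + Complex.I) x =
      Complex.log (1 * (r + Complex.I - x)) - Complex.log (1 * (r - Complex.I - x)) :=
    logIncrement_eq_log_sub_log fun z hz => Or.inl <| by
      simp [re_eq_of_mem_segment (by simp) hz, hx.2]
  have htop : logIncrement (r + Complex.I) (l + Complex.I) x =
      Complex.log (1 * (l + Complex.I - x)) - Complex.log (1 * (r + Complex.I - x)) :=
    logIncrement_eq_log_sub_log fun z hz => Or.inr <| by
      simp [im_eq_of_mem_segment (by simp) hz]
  rw [contourLogIncrement, hleft, hbottom, hright, htop, neg_one_mul, neg_one_mul,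
    log_neg_of_im_neg (by simp), log_neg_of_im_pos (by simp)]
  simp only [one_mul]
  ring

end Rectangle

section ContourIntegral

variable {E : Type*} [NormedAddCommGroup E] [InnerProductSpace ℂ E] [CompleteSpace E]
  {B : E →L[ℂ] E} {l r : ℝ}

theorem lineIntegral_contour_smul_resolvent [IsStarNormal B]
    (hB : ∀ x ∈ spectrum ℂ B, x ∉ range (contour l r)) :
    lineIntegral (contour l r) (fun z => z • resolvent B z) =
      cfc (fun x => x * contourLogIncrement l r x) B := by
  have hint {p q : ℂ} (h : ∀ x ∈ spectrum ℂ B, x ∉ segment ℝ p q) :=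
    curveIntegrable_segment_smul_resolvent continuousOn_id h
  have heval {p q : ℂ} (h : ∀ x ∈ spectrum ℂ B, x ∉ segment ℝ p q) :
      curveIntegral (fun z => ContinuousLinearMap.toSpanSingleton ℂ (id z • resolvent B z))
        (Path.segment p q) = cfc (fun x => (q - p) + x * logIncrement p q x) B :=
    (lineIntegral_segment_smul_resolvent continuousOn_id h).trans
      (cfc_congr fun x hx => integral_cauchyKernel_id (h x hx))
  have hcont {p q : ℂ} (h : ∀ x ∈ spectrum ℂ B, x ∉ segment ℝ p q) :
      ContinuousOn (fun x => (q - p) + x * logIncrement p q x) (spectrum ℂ B) :=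
    continuousOn_const.add (continuousOn_id.mul (continuousOn_logIncrement h))
  simp only [range_contour, mem_union, not_or, forall_and] at hB
  obtain ⟨h₁, h₂, h₃, h₄⟩ := hB
  change curveIntegral (fun z => ContinuousLinearMap.toSpanSingleton ℂ (id z • resolvent B z)) _ = _
  rw [contour,
    curveIntegral_trans (hint h₁) ((hint h₂).trans ((hint h₃).trans (hint h₄))),
    curveIntegral_trans (hint h₂) ((hint h₃).trans (hint h₄)),
    curveIntegral_trans (hint h₃) (hint h₄), heval h₁, heval h₂, heval h₃, heval h₄,
    ← cfc_add B _ _ (hcont h₃) (hcont h₄),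
    ← cfc_add B _ _ (hcont h₂) ((hcont h₃).fun_add (hcont h₄)),
    ← cfc_add B _ _ (hcont h₁) ((hcont h₂).fun_add ((hcont h₃).fun_add (hcont h₄)))]
  refine cfc_congr fun x _ => ?_
  simp only [contourLogIncrement]
  ring

theorem negativePart_eq_cfc (hB : IsSelfAdjoint B) :
    negativePart B = cfc (fun x : ℂ => ((x.re⁻ : ℝ) : ℂ)) B := by
  rw [negativePart, CFC.negPart_def, cfcₙ_eq_cfc (hf0 := by simp), cfc_real_eq_complex _ hB]

theorem neg_negativePart_eq_lineIntegral (hB : IsSelfAdjoint B) (hr : r < 0)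
    (h : ∀ x : ℝ, (x : ℂ) ∈ spectrum ℂ B → l < x ∧ (x < r ∨ 0 ≤ x)) :
    -negativePart B = (1 / (2 * (Real.pi : ℂ) * Complex.I)) •
      lineIntegral (contour l r) (fun z => z • resolvent B z) := by
  have : IsStarNormal B := hB.isStarNormal
  have hreal : ∀ x ∈ spectrum ℂ B, ∃ y : ℝ, x = y := fun x hx => ⟨_, hB.mem_spectrum_eq_re hx⟩
  have havoid : ∀ x ∈ spectrum ℂ B, x ∉ range (contour l r) := fun x hx => by
    obtain ⟨y, rfl⟩ := hreal x hx
    obtain ⟨hly, hry | hy⟩ := h y hx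
    · exact ofReal_notMem_range_contour hly.ne hry.ne'
    · exact ofReal_notMem_range_contour hly.ne (hr.trans_le hy).ne
  have hvalue : ∀ x ∈ spectrum ℂ B, x * contourLogIncrement l r x =
      (2 * (Real.pi : ℂ) * Complex.I) * -((x.re⁻ : ℝ) : ℂ) := fun x hx => by
    obtain ⟨y, rfl⟩ := hreal x hx
    obtain ⟨hly, hry | hy⟩ := h y hx
    · rw [contourLogIncrement_of_mem_Ioo ⟨hly, hry⟩, Complex.ofReal_re,
        negPart_of_nonpos (hry.trans hr).le]
      push_cast
      ring
    · rw [contourLogIncrement_of_lt hly (hr.trans_le hy), Complex.ofReal_re, negPart_of_nonneg hy]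
      simp
  rw [lineIntegral_contour_smul_resolvent havoid, negativePart_eq_cfc hB, ← cfc_neg,
    cfc_congr hvalue, cfc_const_mul _ _ B (by fun_prop), smul_smul, one_div,
    inv_mul_cancel₀ Complex.two_pi_I_ne_zero, one_smul]

end ContourIntegral

/-! ### Spectral gaps of self-adjoint operators -/

section SpectralGap

variable {E : Type*} [NormedAddCommGroup E] [InnerProductSpace ℂ E] {B H : E →L[ℂ] E}

theorem gap_le_norm {x : ℂ} (hx : x ∈ spectrum ℂ B) (hx0 : x ≠ 0) : gap B ≤ ‖x‖ := by
  simpa [gap] using Metric.infDist_le_dist_of_mem (x := (0 : ℂ))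
    (show x ∈ spectrum ℂ B \ {0} from ⟨hx, hx0⟩)

variable [CompleteSpace E]

theorem isUnit_of_norm_le_mul_norm_apply (hB : IsStarNormal B) {K : ℝ}
    (h : ∀ ψ, ‖ψ‖ ≤ K * ‖B ψ‖) : IsUnit B := by
  rw [ContinuousLinearMap.isUnit_iff_bijective,
    ContinuousLinearMap.bijective_iff_dense_range_and_antilipschitz]
  refine ⟨?_, K.toNNReal, AddMonoidHomClass.antilipschitz_of_bound B fun ψ => (h ψ).trans ?_⟩
  · rw [Submodule.topologicalClosure_eq_top_iff,
      ContinuousLinearMap.IsStarNormal.orthogonal_range hB, Submodule.eq_bot_iff]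
    intro ψ hψ
    have hBψ : B ψ = 0 := hψ
    simpa [hBψ] using h ψ
  · gcongr
    exact Real.le_coe_toNNReal K

theorem le_gap (hB : IsStarNormal B) (hB0 : B ≠ 0) {c : ℝ}
    (h : ∀ x ∈ spectrum ℂ B, x ≠ 0 → c ≤ ‖x‖) : c ≤ gap B := by
  have hne : (spectrum ℂ B \ {0}).Nonempty := by
    by_contra hempty
    rw [not_nonempty_iff_eq_empty, sdiff_eq_empty] at hempty
    exact hB0 (CFC.eq_zero_of_spectrum_subset_zero (R := ℂ) B hempty hB)
  refine (Metric.le_infDist hne).mpr fun x hx => ?_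
  rw [dist_zero_left]
  exact h x hx.1 hx.2

theorem eq_zero_or_lt_norm_of_mem_spectrum_add (hB : IsStarNormal B) {c d : ℝ} (hHd : ‖H‖ < d)
    (hHc : ‖H‖ < c) (h : ∀ x ∈ spectrum ℂ (B + H), x ≠ 0 → c ≤ ‖x‖) {x : ℂ}
    (hx : x ∈ spectrum ℂ (B + H)) : x = 0 ∨ gap B - d < ‖x‖ := by
  obtain ⟨y, hy, hxy⟩ := exists_mem_spectrum_norm_sub_lt (lt_min hHd hHc) hx
  rcases eq_or_ne y 0 with rfl | hy0
  · left
    by_contra hx0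
    rw [sub_zero] at hxy
    exact (hxy.trans_le (min_le_right _ _)).not_ge (h x hx hx0)
  · right
    have hyx := norm_sub_norm_le y x
    rw [norm_sub_rev] at hyx
    linarith [gap_le_norm hy hy0, min_le_left d c]

theorem isSimpleIsolatedEigenvalue_of_le_norm_sub {μ : ℂ} {c : ℝ} (hc : 0 < c)
    (hdim : Module.finrank ℂ (Module.End.eigenspace (B : E →ₗ[ℂ] E) μ) = 1)
    (h : ∀ x ∈ spectrum ℂ B, x ≠ μ → c ≤ ‖x - μ‖) : IsSimpleIsolatedEigenvalue B μ := by
  have hμ : Module.End.HasEigenvalue (B : E →ₗ[ℂ] E) μ := by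
    rw [Module.End.hasEigenvalue_iff]
    intro hbot
    rw [hbot, finrank_bot] at hdim
    exact zero_ne_one hdim
  have hspec : μ ∈ spectrum ℂ B := fun hu => by
    obtain ⟨v, hv⟩ := hμ.exists_hasEigenvector
    have hBv : B v = μ • v := hv.apply_eq_smul
    refine hv.2 ((ContinuousLinearMap.isUnit_iff_bijective.mp hu).1 ?_)
    simp [Algebra.algebraMap_eq_smul_one, hBv]
  refine ⟨hμ, hdim, c, hc, Subset.antisymm (fun x hx => ?_) ?_⟩
  · by_contra hxμ
    exact (mem_ball_iff_norm.mp hx.2).not_ge (h x hx.1 hxμ)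
  · exact singleton_subset_iff.mpr ⟨hspec, Metric.mem_ball_self hc⟩

end SpectralGap

section ContourStability

variable {E : Type*} [NormedAddCommGroup E] [InnerProductSpace ℂ E] [CompleteSpace E]
  {B H : E →L[ℂ] E}

theorem norm_resolvent_le_of_mem_range_contour (hB : IsSelfAdjoint B) {l r d : ℝ} (hd : 0 < d)
    (hd1 : d ≤ 1) (hr : r ≤ -d)
    (h : ∀ x : ℝ, (x : ℂ) ∈ spectrum ℂ B → l + d ≤ x ∧ (x + d ≤ r ∨ 0 ≤ x)) {z : ℂ}
    (hz : z ∈ range (contour l r)) :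
    IsUnit (algebraMap ℂ (E →L[ℂ] E) z - B) ∧ ‖resolvent B z‖ ≤ d⁻¹ := by
  have : IsStarNormal B := hB.isStarNormal
  have hdist : ∀ x ∈ spectrum ℂ B, d ≤ ‖z - x‖ := fun x hx => by
    obtain ⟨y, rfl⟩ : ∃ y : ℝ, x = y := ⟨_, hB.mem_spectrum_eq_re hx⟩
    obtain ⟨hly, hry⟩ := h y hx
    refine le_trans ?_ (min_le_norm_sub_ofReal_of_mem_range_contour hz y)
    refine le_min (le_min (le_abs.mpr (Or.inr (by linarith))) (le_abs.mpr ?_)) hd1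
    exact hry.imp (fun _ => by linarith) (fun _ => by linarith)
  refine ⟨spectrum.notMem_iff.mp fun hz' => ?_, norm_resolvent_le hd hdist⟩
  simpa using hd.trans_le (hdist z hz')

theorem abs_le_norm_of_ofReal_mem_spectrum {x : ℝ} (hx : (x : ℂ) ∈ spectrum ℂ B) : |x| ≤ ‖B‖ := by
  simpa using (spectrum.norm_le_norm_mul_of_mem hx).trans
    (mul_le_of_le_one_right (norm_nonneg _) ContinuousLinearMap.norm_id_le)

theorem exists_contour_neg_negativePart_add (hB : IsSelfAdjoint B) (hgap : 0 < gap B) {c : ℝ}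
    (hc : 0 < c) :
    ∃ l : ℝ, l < -(gap B) / 2 ∧ ∃ C : ℝ, 0 ≤ C ∧ ∃ η : ℝ, 0 < η ∧
      ∀ H : E →L[ℂ] E, IsSelfAdjoint H → ‖H‖ ≤ η →
        (∀ x ∈ spectrum ℂ (B + H), x ≠ 0 → c ≤ ‖x‖) →
        (∀ z ∈ range (contour l (-(gap B) / 2)),
          IsUnit (algebraMap ℂ (E →L[ℂ] E) z - (B + H)) ∧ ‖resolvent (B + H) z‖ ≤ C) ∧
        -negativePart (B + H) = (1 / (2 * (Real.pi : ℂ) * Complex.I)) •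
          lineIntegral (contour l (-(gap B) / 2)) (fun z => z • resolvent (B + H) z) := by
  set g := gap B
  set d := min (g / 4) 1
  have hd : 0 < d := by positivity
  have hdg : d ≤ g / 4 := min_le_left _ _
  refine ⟨-(‖B‖ + g), by linarith [norm_nonneg B], d⁻¹, by positivity, min (g / 5) (c / 2),
    by positivity, fun H hH hHη hspec => ?_⟩
  obtain ⟨hHg, hHc⟩ := le_min_iff.mp hHη
  have hreal : ∀ x : ℝ, (x : ℂ) ∈ spectrum ℂ (B + H) →
      -(‖B‖ + g) + d ≤ x ∧ (x + d ≤ -g / 2 ∨ 0 ≤ x) := fun x hx => by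
    have hx_norm := (abs_le_norm_of_ofReal_mem_spectrum hx).trans (norm_add_le B H)
    have hx_gap := eq_zero_or_lt_norm_of_mem_spectrum_add hB.isStarNormal (d := g / 4)
      (by linarith) (by linarith) hspec hx
    rw [Complex.ofReal_eq_zero, Complex.norm_real, Real.norm_eq_abs] at hx_gap
    refine ⟨by linarith [neg_abs_le x], ?_⟩
    rcases lt_or_ge x 0 with hx0 | hx0
    · rw [abs_of_neg hx0] at hx_gap
      exact Or.inl (by linarith [hx_gap.resolve_left hx0.ne])
    · exact Or.inr hx0
  refine ⟨fun z hz => norm_resolvent_le_of_mem_range_contour (hB.add hH) hd (min_le_right _ _)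
    (by linarith) hreal hz, neg_negativePart_eq_lineIntegral (hB.add hH) (by linarith)
      fun x hx => ⟨by linarith [(hreal x hx).1], (hreal x hx).2.imp_left fun _ => by linarith⟩⟩

end ContourStability

/-! ### Chiral symmetry -/

section Chiral

variable {E : Type*} [NormedAddCommGroup E] [InnerProductSpace ℂ E] {B H P : E →L[ℂ] E} {c : ℝ}

theorem sub_norm_mul_le_norm_add_apply {φ : E} (h : c * ‖φ‖ ≤ ‖B φ‖) :
    (c - ‖H‖) * ‖φ‖ ≤ ‖(B + H) φ‖ := by
  have hadd : ‖B φ‖ - ‖H φ‖ ≤ ‖(B + H) φ‖ := by simpa using norm_sub_norm_le (B φ) (-H φ)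
  linarith [H.le_opNorm φ, sub_mul c ‖H‖ ‖φ‖]

variable [CompleteSpace E]

theorem sq_mul_norm_le_norm_apply_apply (hB : IsSelfAdjoint B) (hc : 0 ≤ c) {φ : E}
    (h : c * ‖φ‖ ≤ ‖B φ‖) : c ^ 2 * ‖φ‖ ≤ ‖B (B φ)‖ := by
  rcases eq_or_ne φ 0 with rfl | hφ
  · simp
  have hcs : ‖B φ‖ ^ 2 ≤ ‖φ‖ * ‖B (B φ)‖ := by
    have hsymm : inner ℂ (B φ) (B φ) = inner ℂ φ (B (B φ)) :=
      (ContinuousLinearMap.isSelfAdjoint_iff_isSymmetric.mp hB) φ (B φ)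
    have hle := norm_inner_le_norm (𝕜 := ℂ) φ (B (B φ))
    rwa [← hsymm, inner_self_eq_norm_sq_to_K, norm_pow, RCLike.norm_ofReal, abs_norm] at hle
  refine le_of_mul_le_mul_left ?_ (norm_pos_iff.mpr hφ)
  calc ‖φ‖ * (c ^ 2 * ‖φ‖) = (c * ‖φ‖) ^ 2 := by ring
    _ ≤ ‖B φ‖ ^ 2 := by gcongr
    _ ≤ ‖φ‖ * ‖B (B φ)‖ := hcs

theorem le_norm_of_mem_spectrum_of_chiral (hB : IsSelfAdjoint B) (hBP : B * P = (1 - P) * B)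
    (h : ∀ ψ, c * ‖P ψ‖ ≤ ‖B (P ψ)‖) {z : ℂ} (hz : z ∈ spectrum ℂ B) (hz0 : z ≠ 0) : c ≤ ‖z‖ := by
  by_contra! hzc
  have hcz : 0 < c ^ 2 - ‖z‖ ^ 2 := by nlinarith [norm_nonneg z]
  set D := algebraMap ℂ (E →L[ℂ] E) z - B
  have hD : IsStarNormal D := by
    have hreal : IsSelfAdjoint z := Complex.conj_eq_iff_real.mpr ⟨_, hB.mem_spectrum_eq_re hz⟩
    exact ((IsSelfAdjoint.algebraMap (E →L[ℂ] E) hreal).sub hB).isStarNormal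
  have hDψ : ∀ ψ, D ψ = z • ψ - B ψ := fun ψ => by simp [D, Algebra.algebraMap_eq_smul_one]
  have hBPψ : ∀ ψ, B (P ψ) = B ψ - P (B ψ) := DFunLike.congr_fun hBP
  -- As `B` exchanges the sectors, `(B² - z²) P` is a left multiple of `z - B`.
  set R := z • P + B * (1 - P)
  have hfactor : ∀ ψ, B (B (P ψ)) - z ^ 2 • P ψ = -R (D ψ) := fun ψ => by
    simp only [R, hDψ, add_apply, smul_apply,
      mul_apply_eq_comp, sub_apply, one_apply_eq_self,
      map_sub, map_smul, hBPψ]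
    module
  have hP : ∀ ψ, ‖P ψ‖ ≤ ‖R‖ / (c ^ 2 - ‖z‖ ^ 2) * ‖D ψ‖ := fun ψ => by
    have hBB := sq_mul_norm_le_norm_apply_apply hB ((norm_nonneg z).trans hzc.le) (h ψ)
    have hsub := norm_sub_norm_le (B (B (P ψ))) (z ^ 2 • P ψ)
    rw [hfactor, norm_neg, norm_smul, norm_pow] at hsub
    rw [div_mul_eq_mul_div, le_div_iff₀ hcz]
    linarith [R.le_opNorm (D ψ)]
  have hQ : ∀ ψ, ‖(1 - P) ψ‖ ≤
      (‖1 - P‖ + ‖B‖ * (‖R‖ / (c ^ 2 - ‖z‖ ^ 2))) / ‖z‖ * ‖D ψ‖ := fun ψ => by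
    have hz_smul : z • (1 - P) ψ = (1 - P) (D ψ) + B (P ψ) := by
      simp only [hDψ, hBPψ, sub_apply, one_apply_eq_self, map_sub,
        map_smul]
      module
    rw [div_mul_eq_mul_div, le_div_iff₀ (norm_pos_iff.mpr hz0), mul_comm, ← norm_smul, hz_smul,
      add_mul, mul_assoc]
    refine (norm_add_le _ _).trans (add_le_add ((1 - P).le_opNorm _) ?_)
    exact (B.le_opNorm _).trans (by gcongr; exact hP ψ)
  refine hz (isUnit_of_norm_le_mul_norm_apply (K := ‖R‖ / (c ^ 2 - ‖z‖ ^ 2) +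
    (‖1 - P‖ + ‖B‖ * (‖R‖ / (c ^ 2 - ‖z‖ ^ 2))) / ‖z‖) hD fun ψ => ?_)
  calc ‖ψ‖ = ‖P ψ + (1 - P) ψ‖ := by simp
    _ ≤ _ := (norm_add_le _ _).trans (add_le_add (hP ψ) (hQ ψ))
    _ = _ := (add_mul _ _ _).symm

theorem isUnit_of_chiral (hB : IsStarNormal B) (hBP : B * P = (1 - P) * B) (hc : 0 < c)
    (hP : ∀ ψ, c * ‖P ψ‖ ≤ ‖B (P ψ)‖) (hQ : ∀ ψ, c * ‖(1 - P) ψ‖ ≤ ‖B ((1 - P) ψ)‖) :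
    IsUnit B := by
  have hBPψ : ∀ ψ, B (P ψ) = (1 - P) (B ψ) := DFunLike.congr_fun hBP
  have hBQψ : ∀ ψ, B ((1 - P) ψ) = P (B ψ) := fun ψ => by simp [hBPψ]
  refine isUnit_of_norm_le_mul_norm_apply (K := (‖1 - P‖ + ‖P‖) / c) hB fun ψ => ?_
  rw [div_mul_eq_mul_div, le_div_iff₀ hc, mul_comm]
  calc c * ‖ψ‖ = c * ‖P ψ + (1 - P) ψ‖ := by simp
    _ ≤ c * ‖P ψ‖ + c * ‖(1 - P) ψ‖ := by rw [← mul_add]; gcongr; exact norm_add_le _ _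
    _ ≤ ‖(1 - P) (B ψ)‖ + ‖P (B ψ)‖ := by rw [← hBPψ, ← hBQψ]; exact add_le_add (hP ψ) (hQ ψ)
    _ ≤ (‖1 - P‖ + ‖P‖) * ‖B ψ‖ := by
      rw [add_mul]
      exact add_le_add ((1 - P).le_opNorm _) (P.le_opNorm _)

end Chiral

/-! ### Square-summable solutions of one-step inequalities -/

section OneStep

theorem add_mul_sq_le {r : ℝ} (hr0 : 0 ≤ r) (hr : r < 1) (x y : ℝ) :
    (x + r * y) ^ 2 ≤ x ^ 2 / (1 - r) + r * y ^ 2 := by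
  have hr' : 0 < 1 - r := sub_pos.mpr hr
  have hdiff : x ^ 2 / (1 - r) + r * y ^ 2 - (x + r * y) ^ 2 =
      r / (1 - r) * (x - (1 - r) * y) ^ 2 := by
    field_simp
    ring
  rw [← sub_nonneg, hdiff]
  positivity

variable {ι : Type*} {s b : ι → ι}

theorem tsum_sq_comp_le (hs : s.Injective) {y : ι → ℝ} (hy : Summable fun k => y k ^ 2) :
    ∑' k, y (s k) ^ 2 ≤ ∑' k, y k ^ 2 :=
  tsum_comp_le_tsum_of_inj hy (fun k => sq_nonneg (y k)) hs

theorem tsum_sq_le_of_le_add_mul_comp (hs : s.Injective) {y g : ι → ℝ} {r : ℝ} (hr0 : 0 ≤ r)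
    (hr : r < 1) (hy0 : ∀ k, 0 ≤ y k) (hy : Summable fun k => y k ^ 2)
    (hg : Summable fun k => g k ^ 2) (h : ∀ k, y k ≤ g k + r * y (s k)) :
    ∑' k, y k ^ 2 ≤ (∑' k, g k ^ 2) / (1 - r) ^ 2 := by
  have hr' : 0 < 1 - r := sub_pos.mpr hr
  have hys : Summable fun k => y (s k) ^ 2 := hy.comp_injective hs
  have hsum : ∑' k, y k ^ 2 ≤ (∑' k, g k ^ 2) / (1 - r) + r * ∑' k, y k ^ 2 :=
    calc ∑' k, y k ^ 2 ≤ ∑' k, (g k ^ 2 / (1 - r) + r * y (s k) ^ 2) :=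
          hy.tsum_le_tsum (fun k => (pow_le_pow_left₀ (hy0 k) (h k) 2).trans
            (add_mul_sq_le hr0 hr _ _)) ((hg.div_const _).add (hys.mul_left _))
      _ = (∑' k, g k ^ 2) / (1 - r) + r * ∑' k, y (s k) ^ 2 := by
          rw [(hg.div_const _).tsum_add (hys.mul_left _), tsum_div_const, tsum_mul_left]
      _ ≤ (∑' k, g k ^ 2) / (1 - r) + r * ∑' k, y k ^ 2 := by
          linarith [mul_le_mul_of_nonneg_left (tsum_sq_comp_le hs hy) hr0]
  rw [sq, ← div_div, le_div_iff₀ hr']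
  linarith

theorem tsum_sq_le_of_weight (hs : s.Injective) {x f ρ w : ι → ℝ} {r V : ℝ} (hr0 : 0 ≤ r)
    (hr : r < 1) (hx0 : ∀ k, 0 ≤ x k) (hf0 : ∀ k, 0 ≤ f k) (hx : Summable fun k => x k ^ 2)
    (hf : Summable fun k => f k ^ 2) (hw : ∀ k, 1 ≤ w k) (hwV : ∀ k, w k ≤ V)
    (hρ : ∀ k, ρ k * w k ≤ r * w (s k)) (h : ∀ k, x k ≤ f k + ρ k * x (s k)) :
    ∑' k, x k ^ 2 ≤ (V / (1 - r)) ^ 2 * ∑' k, f k ^ 2 := by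
  have hw0 : ∀ k, 0 ≤ w k := fun k => zero_le_one.trans (hw k)
  have hwx : Summable fun k => (w k * x k) ^ 2 := by
    refine (hx.mul_left (V ^ 2)).of_nonneg_of_le (fun k => sq_nonneg _) fun k => ?_
    rw [mul_pow]
    exact mul_le_mul_of_nonneg_right (pow_le_pow_left₀ (hw0 k) (hwV k) 2) (sq_nonneg _)
  have hstep : ∀ k, w k * x k ≤ V * f k + r * (w (s k) * x (s k)) := fun k =>
    calc w k * x k ≤ w k * f k + ρ k * w k * x (s k) := by
          linarith [mul_le_mul_of_nonneg_left (h k) (hw0 k)]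
      _ ≤ V * f k + r * w (s k) * x (s k) :=
          add_le_add (mul_le_mul_of_nonneg_right (hwV k) (hf0 k))
            (mul_le_mul_of_nonneg_right (hρ k) (hx0 _))
      _ = V * f k + r * (w (s k) * x (s k)) := by ring
  calc ∑' k, x k ^ 2 ≤ ∑' k, (w k * x k) ^ 2 := hx.tsum_le_tsum
        (fun k => pow_le_pow_left₀ (hx0 k) (le_mul_of_one_le_left (hx0 k) (hw k)) 2) hwx
    _ ≤ (∑' k, (V * f k) ^ 2) / (1 - r) ^ 2 :=
        tsum_sq_le_of_le_add_mul_comp hs hr0 hr (fun k => mul_nonneg (hw0 k) (hx0 k)) hwx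
          (by simpa only [mul_pow] using hf.mul_left (V ^ 2)) hstep
    _ = (V / (1 - r)) ^ 2 * ∑' k, f k ^ 2 := by
        simp only [mul_pow, div_pow, tsum_mul_left]
        ring

-- The weight jumps by the factor `ρ j / r` when the orbit of `s` passes an exceptional index `j`;
-- the height `h` prevents orbits from passing it again.
theorem exists_weight {h : ι → ℤ} (hh : ∀ k, h k < h (s k)) {ρ : ι → ℝ} {r : ℝ} (hr : 0 < r)
    (hρ : ∀ᶠ k in cofinite, ρ k ≤ r) :
    ∃ (V : ℝ) (w : ι → ℝ), (∀ k, 1 ≤ w k) ∧ (∀ k, w k ≤ V) ∧ ∀ k, ρ k * w k ≤ r * w (s k) := by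
  classical
  set F := (eventually_cofinite.mp hρ).toFinset
  set q : ι → ℝ := fun j => max 1 (ρ j / r)
  have hq : ∀ j, 1 ≤ q j := fun j => le_max_left _ _
  have hq0 : ∀ j, 0 ≤ q j := fun j => zero_le_one.trans (hq j)
  have hmono : ∀ {S T : Finset ι}, S ⊆ T → ∏ j ∈ S, q j ≤ ∏ j ∈ T, q j := fun hST =>
    Finset.prod_le_prod_of_subset_of_one_le hST (fun j _ => hq0 j) fun j _ _ => hq j
  refine ⟨∏ j ∈ F, q j, fun k => ∏ j ∈ F with h j < h k, q j, fun k => ?_,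
    fun k => hmono (Finset.filter_subset _ _), fun k => ?_⟩
  · simpa only [Finset.prod_empty] using hmono (Finset.empty_subset {j ∈ F | h j < h k})
  have hw0 : 0 ≤ ∏ j ∈ F with h j < h k, q j := Finset.prod_nonneg fun j _ => hq0 j
  by_cases hk : ρ k ≤ r
  · exact mul_le_mul hk (hmono (Finset.monotone_filter_right _ fun j _ hj => hj.trans (hh k))) hw0
      hr.le
  · have hkF : k ∈ F := by simpa [F] using hk
    calc ρ k * ∏ j ∈ F with h j < h k, q j
        ≤ r * q k * ∏ j ∈ F with h j < h k, q j := by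
          gcongr
          exact (div_le_iff₀' hr).mp (le_max_right _ _)
      _ = r * ∏ j ∈ insert k {j ∈ F | h j < h k}, q j := by
          have : k ∉ ({j ∈ F | h j < h k} : Finset ι) := by simp
          rw [Finset.prod_insert this, mul_assoc]
      _ ≤ r * ∏ j ∈ F with h j < h (s k), q j := by
          refine mul_le_mul_of_nonneg_left (hmono (Finset.insert_subset_iff.mpr
            ⟨Finset.mem_filter.mpr ⟨hkF, hh k⟩, ?_⟩)) hr.le
          exact Finset.monotone_filter_right _ fun j _ hj => hj.trans (hh k)

variable {F : Type*} [NormedAddCommGroup F]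

theorem summable_norm_sq (ψ : lp (fun _ : ι => F) 2) : Summable fun k => ‖ψ k‖ ^ 2 := by
  simpa using (lp.memℓp ψ).summable (by norm_num)

theorem norm_sq_eq_tsum (ψ : lp (fun _ : ι => F) 2) : ‖ψ‖ ^ 2 = ∑' k, ‖ψ k‖ ^ 2 := by
  simpa using lp.norm_rpow_eq_tsum (by norm_num) ψ

theorem exists_norm_le_mul_norm (hs : s.Injective) (hb : b.Injective) {h : ι → ℤ}
    (hh : ∀ k, h k < h (s k)) {ρ : ι → ℝ} {r : ℝ} (hr0 : 0 < r) (hr : r < 1)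
    (hρ : ∀ᶠ k in cofinite, ρ k ≤ r) {C : ℝ} (hC : 0 ≤ C) :
    ∃ K : ℝ, ∀ ψ φ : lp (fun _ : ι => F) 2,
      (∀ k, ‖ψ k‖ ≤ C * ‖φ (b k)‖ + ρ k * ‖ψ (s k)‖) → ‖ψ‖ ≤ K * ‖φ‖ := by
  obtain ⟨V, w, hw, hwV, hρw⟩ := exists_weight hh hr0 hρ
  refine ⟨|V / (1 - r)| * C, fun ψ φ hψ => ?_⟩
  have hφ : Summable fun k => ‖φ (b k)‖ ^ 2 := (summable_norm_sq φ).comp_injective hb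
  refine le_of_sq_le_sq ?_ (by positivity)
  calc ‖ψ‖ ^ 2 = ∑' k, ‖ψ k‖ ^ 2 := norm_sq_eq_tsum ψ
    _ ≤ (V / (1 - r)) ^ 2 * ∑' k, (C * ‖φ (b k)‖) ^ 2 :=
        tsum_sq_le_of_weight hs hr0.le hr (fun k => norm_nonneg _) (fun k => by positivity)
          (summable_norm_sq ψ) (by simpa only [mul_pow] using hφ.mul_left (C ^ 2)) hw hwV hρw hψ
    _ = (V / (1 - r)) ^ 2 * C ^ 2 * ∑' k, ‖φ (b k)‖ ^ 2 := by
        simp only [mul_pow, tsum_mul_left]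
        ring
    _ ≤ (V / (1 - r)) ^ 2 * C ^ 2 * ‖φ‖ ^ 2 := by
        rw [norm_sq_eq_tsum φ]
        exact mul_le_mul_of_nonneg_left (tsum_sq_comp_le hb (summable_norm_sq φ)) (by positivity)
    _ = (|V / (1 - r)| * C * ‖φ‖) ^ 2 := by rw [mul_pow, mul_pow, sq_abs]

end OneStep

/-! ### Hopping operators on the two sublattices -/

section Sublattices

/-- The restriction of a vector to the sites in `S`, as an operator on `ℓ²(ℤ, ℂ)`. -/
def siteProj (S : Set ℤ) : Hil →L[ℂ] Hil :=
  LinearMap.mkContinuous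
    { toFun := fun ψ => ⟨S.indicator ψ, (lp.memℓp ψ).mono' fun _ => norm_indicator_le_norm_self ψ _⟩
      map_add' := fun φ ψ => by
        ext n
        exact congrFun (indicator_add S φ ψ) n
      map_smul' := fun c ψ => by
        ext n
        exact congrFun (indicator_const_smul S c ψ) n }
    1 fun ψ => by
      rw [one_mul]
      exact lp.norm_mono two_ne_zero fun n => norm_indicator_le_norm_self ψ n

theorem siteProj_apply_of_mem {S : Set ℤ} (ψ : Hil) {n : ℤ} (hn : n ∈ S) :
    siteProj S ψ n = ψ n :=
  indicator_of_mem hn ψ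

theorem siteProj_apply_of_notMem {S : Set ℤ} (ψ : Hil) {n : ℤ} (hn : n ∉ S) :
    siteProj S ψ n = 0 :=
  indicator_of_notMem hn ψ

theorem one_sub_siteProj (S : Set ℤ) : 1 - siteProj S = siteProj Sᶜ := by
  ext ψ n
  exact (congrFun (indicator_compl S ψ) n).symm

theorem hop_mul_siteProj (a : Seq) {S : Set ℤ} (hS : ∀ n, n + 1 ∈ S ↔ n ∉ S) :
    hop a * siteProj S = (1 - siteProj S) * hop a := by
  have hS' : ∀ n, n - 1 ∈ S ↔ n ∉ S := fun n => by
    rw [← not_iff_not, ← hS, sub_add_cancel, not_not]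
  rw [one_sub_siteProj]
  ext ψ n
  change hop a (siteProj S ψ) n = siteProj Sᶜ (hop a ψ) n
  rw [hop_apply]
  by_cases hn : n ∈ S
  · rw [siteProj_apply_of_notMem ψ (by simpa [hS'] using hn),
      siteProj_apply_of_notMem ψ (by simpa [hS] using hn),
      siteProj_apply_of_notMem _ (notMem_compl_iff.mpr hn), mul_zero, mul_zero, add_zero]
  · rw [siteProj_apply_of_mem ψ ((hS' n).mpr hn), siteProj_apply_of_mem ψ ((hS n).mpr hn),
      siteProj_apply_of_mem _ hn, hop_apply]

theorem norm_le_of_eq_mul_add_mul {α β : ℝ} {x y z : ℂ} (hα : α ≠ 0)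
    (h : z = (α : ℂ) * x + (β : ℂ) * y) : ‖x‖ ≤ |α|⁻¹ * ‖z‖ + |β| / |α| * ‖y‖ := by
  have hα' : 0 < |α| := abs_pos.mpr hα
  have hle : |α| * ‖x‖ ≤ ‖z‖ + |β| * ‖y‖ := by
    simpa [h] using norm_sub_le z ((β : ℂ) * y)
  rw [inv_mul_eq_div, div_mul_eq_mul_div, ← add_div, le_div_iff₀' hα']
  exact hle

theorem norm_le_hop_apply_add_one {a : Seq} {k : ℤ} (hk : a k ≠ 0) (ψ : Hil) :
    ‖ψ k‖ ≤ |a k|⁻¹ * ‖hop a ψ (k + 1)‖ + |a (k + 1)| / |a k| * ‖ψ (k + 2)‖ :=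
  norm_le_of_eq_mul_add_mul hk (by
    rw [hop_apply, add_sub_cancel_right, add_assoc, one_add_one_eq_two])

theorem norm_le_hop_apply_sub_one {a : Seq} {k : ℤ} (hk : a (k - 1) ≠ 0) (ψ : Hil) :
    ‖ψ k‖ ≤ |a (k - 1)|⁻¹ * ‖hop a ψ (k - 1)‖ + |a (k - 2)| / |a (k - 1)| * ‖ψ (k - 2)‖ :=
  norm_le_of_eq_mul_add_mul hk (by
    rw [hop_apply, sub_sub, one_add_one_eq_two, sub_add_cancel, add_comm])

-- `R` collects the sites whose amplitude is controlled from the right; the others are controlled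
-- from the left. As `R` is an upper set, one never moves back across its boundary.
theorem exists_mul_norm_siteProj_le {a : Seq} {R S : Set ℤ} (hR : IsUpperSet R) {τ r : ℝ}
    (hτ : 0 < τ) (ha : ∀ n, τ ≤ |a n|) (hr0 : 0 < r) (hr : r < 1)
    (hright : ∀ᶠ k in cofinite, k ∈ S → k ∈ R → |a (k + 1)| ≤ r * |a k|)
    (hleft : ∀ᶠ k in cofinite, k ∈ S → k ∉ R → |a (k - 2)| ≤ r * |a (k - 1)|) :
    ∃ c > 0, ∀ ψ, c * ‖siteProj S ψ‖ ≤ ‖hop a (siteProj S ψ)‖ := by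
  classical
  have hpos : ∀ n, 0 < |a n| := fun n => hτ.trans_le (ha n)
  set ρ : ℤ → ℝ := fun k => if k ∈ S then
    if k ∈ R then |a (k + 1)| / |a k| else |a (k - 2)| / |a (k - 1)| else 0
  have hρ : ∀ᶠ k in cofinite, ρ k ≤ r := by
    filter_upwards [hright, hleft] with k hk_right hk_left
    simp only [ρ]
    split_ifs with hkS hkR
    · exact (div_le_iff₀ (hpos _)).mpr (hk_right hkS hkR)
    · exact (div_le_iff₀ (hpos _)).mpr (hk_left hkS hkR)
    · exact hr0.le
  have hinj : ∀ d : ℤ, 0 ≤ d → Function.Injective fun k => if k ∈ R then k + d else k - d :=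
    fun d hd j k hjk => by
      have hjR : j ≤ k → j ∈ R → k ∈ R := fun h => hR h
      have hkR : k ≤ j → k ∈ R → j ∈ R := fun h => hR h
      grind
  obtain ⟨K, hK⟩ := exists_norm_le_mul_norm (F := ℂ) (hinj 2 zero_le_two) (hinj 1 zero_le_one)
    (h := fun k => if k ∈ R then k else -k) (fun k => by
      have hk2 : k ∈ R → k + 2 ∈ R := hR (by omega)
      have hk2' : k - 2 ∈ R → k ∈ R := hR (by omega)
      grind) hr0 hr hρ (inv_nonneg.mpr hτ.le)
  have hC : 0 < max K 1 := by positivity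
  refine ⟨(max K 1)⁻¹, inv_pos.mpr hC, fun ψ => (inv_mul_le_iff₀ hC).mpr ?_⟩
  refine (hK (siteProj S ψ) (hop a (siteProj S ψ)) fun k => ?_).trans
    (mul_le_mul_of_nonneg_right (le_max_left _ _) (norm_nonneg _))
  by_cases hkS : k ∉ S
  · rw [siteProj_apply_of_notMem ψ hkS, norm_zero]
    simp only [ρ, if_neg hkS]
    positivity
  simp only [ρ, if_pos (not_not.mp hkS)]
  split_ifs
  · exact (norm_le_hop_apply_add_one (abs_pos.mp (hpos k)) _).trans (by gcongr; exact ha k)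
  · exact (norm_le_hop_apply_sub_one (abs_pos.mp (hpos _)) _).trans (by gcongr; exact ha _)

end Sublattices

section Dominance

/-- Along the filter `l`, every bond of the class `p` is at least `1 / r` times as strong as its two
neighbours. -/
def DominatesAlong (a : ℤ → ℝ) (r : ℝ) (p : ℤ → Prop) (l : Filter ℤ) : Prop :=
  ∀ᶠ n in l, p n → |a (n - 1)| ≤ r * |a n| ∧ |a (n + 1)| ≤ r * |a n|

variable {a : Seq} {τ r : ℝ}

theorem exists_mul_norm_even_le_of_cofinite (hτ : 0 < τ) (ha : ∀ n, τ ≤ |a n|) (hr0 : 0 < r)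
    (hr : r < 1) (h : DominatesAlong a r Even cofinite) :
    ∃ c > 0, ∀ ψ, c * ‖siteProj {n | Even n} ψ‖ ≤ ‖hop a (siteProj {n | Even n} ψ)‖ :=
  exists_mul_norm_siteProj_le isUpperSet_univ hτ ha hr0 hr
    (h.mono fun _ hk hkS _ => (hk hkS).2) (.of_forall fun k _ hk => (hk (mem_univ k)).elim)

theorem exists_mul_norm_odd_le_of_cofinite (hτ : 0 < τ) (ha : ∀ n, τ ≤ |a n|) (hr0 : 0 < r)
    (hr : r < 1) (h : DominatesAlong a r Even cofinite) :
    ∃ c > 0, ∀ ψ, c * ‖siteProj {n | Even n}ᶜ ψ‖ ≤ ‖hop a (siteProj {n | Even n}ᶜ ψ)‖ := by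
  refine exists_mul_norm_siteProj_le isUpperSet_empty hτ ha hr0 hr
    (.of_forall fun _ _ hk => hk.elim) ?_
  filter_upwards [(sub_left_injective (b := (1 : ℤ))).tendsto_cofinite.eventually h]
    with k hk hkS _
  simpa [sub_sub] using (hk (Int.even_sub_one.mpr hkS)).1

theorem exists_mul_norm_even_le_of_atBot_atTop (hτ : 0 < τ) (ha : ∀ n, τ ≤ |a n|) (hr0 : 0 < r)
    (hr : r < 1) (hbot : DominatesAlong a r Odd atBot) (htop : DominatesAlong a r Even atTop) :
    ∃ c > 0, ∀ ψ, c * ‖siteProj {n | Even n} ψ‖ ≤ ‖hop a (siteProj {n | Even n} ψ)‖ := by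
  refine exists_mul_norm_siteProj_le (isUpperSet_Ici 0) hτ ha hr0 hr ?_ ?_ <;>
    rw [Int.cofinite_eq, eventually_sup]
  · exact ⟨(eventually_lt_atBot 0).mono fun k hk _ hk0 => (hk.not_ge hk0).elim,
      htop.mono fun k hk hkS _ => (hk hkS).2⟩
  · refine ⟨?_, (eventually_ge_atTop 0).mono fun k hk _ hk0 => (hk0 hk).elim⟩
    filter_upwards [(tendsto_atBot_add_const_right atBot (-1 : ℤ) tendsto_id).eventually hbot]
      with k hk hkS _
    simpa [sub_sub, ← sub_eq_add_neg] using (hk (Even.sub_odd hkS odd_one)).1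

end Dominance

/-! ### Perturbed dimers -/

section Dimers

theorem exists_pos_forall_le_abs {t : ℤ → ℝ} (ht0 : ∀ n, t n ≠ 0) {c : ℝ} (hc : 0 < c)
    (h : ∀ᶠ n in cofinite, c ≤ |t n|) : ∃ τ > 0, ∀ n, τ ≤ |t n| := by
  have hexc : ∀ᶠ τ in 𝓝[>] (0 : ℝ), ∀ n ∈ {n | ¬c ≤ |t n|}, τ ≤ |t n| :=
    (eventually_all_finite (eventually_cofinite.mp h)).mpr fun n _ =>
      eventually_nhdsWithin_of_eventually_nhds (eventually_le_nhds (abs_pos.mpr (ht0 n)))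
  obtain ⟨τ, hτ_exc, hτc, hτ⟩ := (hexc.and ((eventually_nhdsWithin_of_eventually_nhds
    (eventually_le_nhds hc)).and eventually_mem_nhdsWithin)).exists
  refine ⟨τ, hτ, fun n => ?_⟩
  by_cases hn : c ≤ |t n|
  · exact hτc.trans hn
  · exact hτ_exc n hn

variable {W δ ε : ℝ} {a : ℤ → ℝ} {l : Filter ℤ}

theorem dominatesAlong_of_le {p : ℤ → Prop} {m M : ℝ} (hm : 0 ≤ m) (hM : 0 < M)
    (hl : ∀ d : ℤ, Tendsto (fun n => n + d) l l) (hp : ∀ n, p n → ¬p (n - 1) ∧ ¬p (n + 1))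
    (h_strong : ∀ᶠ n in l, p n → M ≤ |a n|) (h_weak : ∀ᶠ n in l, ¬p n → |a n| ≤ m) :
    DominatesAlong a (m / M) p l := by
  filter_upwards [h_strong, (hl (-1)).eventually h_weak, (hl 1).eventually h_weak]
    with n hn hn_left hn_right hpn
  have : m ≤ m / M * |a n| := by
    rw [div_mul_eq_mul_div, le_div_iff₀ hM]
    exact mul_le_mul_of_nonneg_left (hn hpn) hm
  exact ⟨(hn_left (hp n hpn).1).trans this, (hn_right (hp n hpn).2).trans this⟩

theorem dominatesAlong_even (hε : 0 < ε) (hεW : ε < W) (hδW : δ ≤ W)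
    (hl : ∀ d : ℤ, Tendsto (fun n => n + d) l l)
    (h : ∀ᶠ n in l, |a n - dimerPlus W δ n| ≤ δ - ε) :
    DominatesAlong a ((W - ε) / (W + ε)) Even l := by
  refine dominatesAlong_of_le (by linarith) (by linarith) hl
    (fun n hn => by simpa [parity_simps] using hn) (h.mono fun n hn hp => ?_)
    (h.mono fun n hn hp => ?_)
  · rw [dimerPlus, hp.neg_one_zpow, abs_le] at hn
    exact (by linarith : W + ε ≤ a n).trans (le_abs_self _)
  · rw [dimerPlus, (Int.not_even_iff_odd.mp hp).neg_one_zpow, abs_le] at hn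
    exact abs_le.mpr ⟨by linarith, by linarith⟩

theorem dominatesAlong_odd (hε : 0 < ε) (hεW : ε < W) (hδW : δ ≤ W)
    (hl : ∀ d : ℤ, Tendsto (fun n => n + d) l l)
    (h : ∀ᶠ n in l, |a n - dimerMinus W δ n| ≤ δ - ε) :
    DominatesAlong a ((W - ε) / (W + ε)) Odd l := by
  refine dominatesAlong_of_le (by linarith) (by linarith) hl
    (fun n hn => by simpa [parity_simps] using hn) (h.mono fun n hn hp => ?_)
    (h.mono fun n hn hp => ?_)
  · rw [dimerMinus, hp.neg_one_zpow, abs_le] at hn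
    exact (by linarith : W + ε ≤ a n).trans (le_abs_self _)
  · rw [dimerMinus, (Int.not_odd_iff_even.mp hp).neg_one_zpow, abs_le] at hn
    exact abs_le.mpr ⟨by linarith, by linarith⟩

theorem sub_le_abs_of_abs_sub_dimerPlus_le (hδ : 0 ≤ δ) {n : ℤ}
    (h : |a n - dimerPlus W δ n| ≤ ε) : W - δ - ε ≤ |a n| := by
  refine le_trans ?_ (le_abs_self _)
  rw [dimerPlus, abs_le] at h
  rcases n.even_or_odd with hn | hn <;> rw [hn.neg_one_zpow] at h <;> linarith

theorem sub_le_abs_of_abs_sub_dimerMinus_le (hδ : 0 ≤ δ) {n : ℤ}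
    (h : |a n - dimerMinus W δ n| ≤ ε) : W - δ - ε ≤ |a n| := by
  refine le_trans ?_ (le_abs_self _)
  rw [dimerMinus, abs_le] at h
  rcases n.even_or_odd with hn | hn <;> rw [hn.neg_one_zpow] at h <;> linarith

theorem eventually_abs_add_sub_le {t : Seq} {d : ℤ → ℝ}
    (ht : Tendsto (fun n => |t n - d n|) l (𝓝 0)) {h : Seq} {η : ℝ} (hη : ‖h‖ < η) :
    ∀ᶠ n in l, |(t + h) n - d n| ≤ η := by
  filter_upwards [ht.eventually_le_const (sub_pos.mpr hη)] with n hn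
  have hhn : |h n| ≤ ‖h‖ := lp.norm_apply_le_norm (by simp) h n
  calc |(t + h) n - d n| = |(t n - d n) + h n| := by
        rw [lp.coeFn_add, Pi.add_apply, add_sub_right_comm]
    _ ≤ |t n - d n| + |h n| := abs_add_le _ _
    _ ≤ η := by linarith

theorem IsHomoclinic.tendsto_cofinite {t : ℤ → ℝ} (ht : IsHomoclinic W δ t) :
    Tendsto (fun n => |t n - dimerPlus W δ n|) cofinite (𝓝 0) := by
  rw [Int.cofinite_eq]
  exact ht.1.sup ht.2

theorem IsHomoclinic.dominatesAlong {t : Seq} (ht : IsHomoclinic W δ t) (hδW : δ < W) {h : Seq}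
    (hh : ‖h‖ < δ / 2) :
    DominatesAlong (t + h : Seq) ((W - δ / 2) / (W + δ / 2)) Even cofinite := by
  have hδ : 0 < δ / 2 := (norm_nonneg h).trans_lt hh
  refine dominatesAlong_even hδ (by linarith) hδW.le
    (fun d => (add_left_injective d).tendsto_cofinite) ?_
  rw [sub_half]
  exact eventually_abs_add_sub_le ht.tendsto_cofinite hh

theorem IsHeteroclinic.dominatesAlong_atBot {t : Seq} (ht : IsHeteroclinic W δ t) (hδW : δ < W)
    {h : Seq} (hh : ‖h‖ < δ / 2) :
    DominatesAlong (t + h : Seq) ((W - δ / 2) / (W + δ / 2)) Odd atBot := by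
  have hδ : 0 < δ / 2 := (norm_nonneg h).trans_lt hh
  refine dominatesAlong_odd hδ (by linarith) hδW.le
    (fun d => tendsto_atBot_add_const_right _ d tendsto_id) ?_
  rw [sub_half]
  exact eventually_abs_add_sub_le ht.1 hh

theorem IsHeteroclinic.dominatesAlong_atTop {t : Seq} (ht : IsHeteroclinic W δ t) (hδW : δ < W)
    {h : Seq} (hh : ‖h‖ < δ / 2) :
    DominatesAlong (t + h : Seq) ((W - δ / 2) / (W + δ / 2)) Even atTop := by
  have hδ : 0 < δ / 2 := (norm_nonneg h).trans_lt hh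
  refine dominatesAlong_even hδ (by linarith) hδW.le
    (fun d => tendsto_atTop_add_const_right _ d tendsto_id) ?_
  rw [sub_half]
  exact eventually_abs_add_sub_le ht.2 hh

theorem eventually_cofinite_le_abs (hδ : 0 ≤ δ) (hδW : δ < W)
    (ha : IsHomoclinic W δ a ∨ IsHeteroclinic W δ a) :
    ∀ᶠ n in cofinite, (W - δ) / 2 ≤ |a n| := by
  have hpos : 0 < (W - δ) / 2 := half_pos (sub_pos.mpr hδW)
  rcases ha with ha | ha
  · filter_upwards [ha.tendsto_cofinite.eventually_le_const hpos] with n hn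
    linarith [sub_le_abs_of_abs_sub_dimerPlus_le hδ hn]
  · rw [Int.cofinite_eq]
    refine eventually_sup.mpr ⟨?_, ?_⟩
    · filter_upwards [ha.1.eventually_le_const hpos] with n hn
      linarith [sub_le_abs_of_abs_sub_dimerMinus_le hδ hn]
    · filter_upwards [ha.2.eventually_le_const hpos] with n hn
      linarith [sub_le_abs_of_abs_sub_dimerPlus_le hδ hn]

theorem IsHomoclinic.not_isHeteroclinic (hδ : 0 < δ) (h : IsHomoclinic W δ a) :
    ¬IsHeteroclinic W δ a := fun h' => by
  obtain ⟨n, hn_plus, hn_minus⟩ :=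
    ((h.1.eventually_lt_const hδ).and (h'.1.eventually_lt_const hδ)).exists
  rw [abs_lt, dimerPlus] at hn_plus
  rw [abs_lt, dimerMinus] at hn_minus
  rcases n.even_or_odd with hn | hn <;> rw [hn.neg_one_zpow] at hn_plus hn_minus <;> linarith

end Dimers

/-! ### Zero modes -/

section ZeroMode

theorem exists_forall_add_one_eq_mul {K : Type*} [GroupWithZero K] {c : ℤ → K}
    (hc : ∀ k, c k ≠ 0) : ∃ u : ℤ → K, u 0 = 1 ∧ ∀ k, u (k + 1) = c k * u k := by
  let u : ℤ → K := fun k => Int.inductionOn' (motive := fun _ => K) k 0 1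
    (fun k _ x => c k * x) fun k _ x => (c (k - 1))⁻¹ * x
  refine ⟨u, Int.inductionOn'_self, fun k => ?_⟩
  rcases le_or_gt 0 k with hk | hk
  · exact Int.inductionOn'_add_one hk
  · have hdown : u (k + 1 - 1) = (c (k + 1 - 1))⁻¹ * u (k + 1) := Int.inductionOn'_sub_one hk
    rw [add_sub_cancel_right] at hdown
    rw [hdown, mul_inv_cancel_left₀ (hc k)]

theorem summable_norm_sq_of_ratio {F : Type*} [SeminormedAddCommGroup F] {u : ℤ → F} {r : ℝ}
    (hr0 : 0 ≤ r) (hr : r < 1) (hbot : ∀ᶠ k in atBot, ‖u k‖ ≤ r * ‖u (k + 1)‖)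
    (htop : ∀ᶠ k in atTop, ‖u (k + 1)‖ ≤ r * ‖u k‖) : Summable fun k => ‖u k‖ ^ 2 := by
  have hr2 : r ^ 2 < 1 := pow_lt_one₀ hr0 hr two_ne_zero
  have hsq : ∀ {x y : F}, ‖x‖ ≤ r * ‖y‖ → ‖‖x‖ ^ 2‖ ≤ r ^ 2 * ‖‖y‖ ^ 2‖ := fun h => by
    rw [norm_pow, norm_pow, norm_norm, norm_norm, ← mul_pow]
    exact pow_le_pow_left₀ (norm_nonneg _) h 2
  have hneg : Tendsto (fun n : ℕ => -((n : ℤ) + 1)) atTop atBot :=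
    tendsto_neg_atTop_atBot.comp
      (tendsto_atTop_add_const_right _ 1 tendsto_natCast_atTop_atTop)
  refine .of_nat_of_neg (summable_of_ratio_norm_eventually_le hr2 ?_)
    (summable_of_ratio_norm_eventually_le hr2 ?_)
  · filter_upwards [tendsto_natCast_atTop_atTop.eventually htop] with n hn
    exact_mod_cast hsq hn
  · filter_upwards [hneg.eventually hbot] with n hn
    rw [neg_add, neg_add_cancel_right] at hn
    rw [Nat.cast_succ, neg_add]
    exact hsq hn

theorem exists_hop_eq_zero_of_recurrence {a : Seq} {u : ℤ → ℂ} (hu : Summable fun k => ‖u k‖ ^ 2)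
    (hrec : ∀ k, (a (2 * k + 1) : ℂ) * u k + (a (2 * k + 2) : ℂ) * u (k + 1) = 0) :
    ∃ ψ : Hil, hop a ψ = 0 ∧ ψ 1 = u 0 := by
  set site : ℤ → ℤ := fun k => 2 * k + 1
  have hsite : site.Injective := fun j k hjk => by simpa [site] using hjk
  set v : ℤ → ℂ := Function.extend site u (0 : ℤ → ℂ)
  have hv_odd : ∀ k, v (2 * k + 1) = u k := hsite.extend_apply u 0
  have hv_even : ∀ k, v (2 * k) = 0 := fun k =>
    Function.extend_apply' u (0 : ℤ → ℂ) _ fun ⟨j, hj⟩ => by simp only [site] at hj; omega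
  have hv : Memℓp v 2 := by
    rw [memℓp_gen_iff (by norm_num), ← hsite.summable_iff fun n hn => by
      simp [v, Function.extend_apply' u (0 : ℤ → ℂ) n hn]]
    simpa [v, Function.comp_def, hsite.extend_apply] using hu
  refine ⟨⟨v, hv⟩, ?_, hv_odd 0⟩
  ext n
  change hop a ⟨v, hv⟩ n = 0
  rw [hop_apply]
  change (a (n - 1) : ℂ) * v (n - 1) + (a n : ℂ) * v (n + 1) = 0
  obtain ⟨k, rfl | rfl⟩ : ∃ k, n = 2 * k + 2 ∨ n = 2 * k + 1 :=
    ⟨(n - 1) / 2, by omega⟩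
  · rw [show 2 * k + 2 - 1 = 2 * k + 1 by ring, show 2 * k + 2 + 1 = 2 * (k + 1) + 1 by ring,
      hv_odd, hv_odd, hrec]
  · rw [add_sub_cancel_right, show 2 * k + 1 + 1 = 2 * (k + 1) by ring, hv_even, hv_even,
      mul_zero, mul_zero, add_zero]

variable {a : Seq}

theorem eq_zero_of_hop_eq_zero (ha : ∀ n, a n ≠ 0) {ψ : Hil} (hψ : hop a ψ = 0) (h0 : ψ 0 = 0)
    (h1 : ψ 1 = 0) : ψ = 0 := by
  have hker : ∀ n, (a (n - 1) : ℂ) * ψ (n - 1) + (a n : ℂ) * ψ (n + 1) = 0 := fun n => by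
    rw [← hop_apply, hψ]
    rfl
  have hpair : ∀ n : ℤ, ψ n = 0 ∧ ψ (n + 1) = 0 := fun n => by
    induction n using Int.induction_on with
    | zero => exact ⟨h0, h1⟩
    | succ n ih => simpa [ih.1, ih.2, ha] using hker (n + 1)
    | pred n ih => simpa [ih.1, ih.2, ha] using hker (-n)
  ext n
  exact (hpair n).1

theorem finrank_eigenspace_hop (ha : ∀ n, a n ≠ 0) (h0 : ∀ ψ, hop a ψ = 0 → ψ 0 = 0) {φ : Hil}
    (hφ : hop a φ = 0) (hφ1 : φ 1 = 1) :
    Module.finrank ℂ (Module.End.eigenspace (hop a : Hil →ₗ[ℂ] Hil) 0) = 1 := by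
  rw [Module.End.eigenspace_zero]
  refine finrank_eq_one (⟨φ, hφ⟩ : LinearMap.ker (hop a : Hil →ₗ[ℂ] Hil)) (fun h => ?_) ?_
  · have hφ0 : φ = 0 := congrArg Subtype.val h
    rw [hφ0] at hφ1
    exact zero_ne_one hφ1
  · rintro ⟨ψ, hψ⟩
    have hψ : hop a ψ = 0 := hψ
    have hdiff : hop a (ψ - ψ 1 • φ) = 0 := by rw [map_sub, map_smul, hψ, hφ, smul_zero, sub_zero]
    have hdiff1 : ψ 1 - ψ 1 * φ 1 = 0 := by rw [hφ1, mul_one, sub_self]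
    have hψφ : ψ - ψ 1 • φ = 0 := eq_zero_of_hop_eq_zero ha hdiff (h0 _ hdiff) hdiff1
    exact ⟨ψ 1, Subtype.ext (sub_eq_zero.mp hψφ).symm⟩

theorem norm_le_mul_norm_of_abs_mul_norm_eq {α β r : ℝ} {x y : ℂ} (hα : α ≠ 0)
    (h : |α| * ‖x‖ = |β| * ‖y‖) (hβ : |β| ≤ r * |α|) : ‖x‖ ≤ r * ‖y‖ := by
  refine le_of_mul_le_mul_left ?_ (abs_pos.mpr hα)
  rw [h, mul_left_comm, ← mul_assoc]
  exact mul_le_mul_of_nonneg_right hβ (norm_nonneg y)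

theorem exists_hop_eq_zero_of_dominatesAlong (ha : ∀ n, a n ≠ 0) {r : ℝ} (hr0 : 0 ≤ r)
    (hr : r < 1) (hbot : DominatesAlong a r Odd atBot) (htop : DominatesAlong a r Even atTop) :
    ∃ ψ : Hil, hop a ψ = 0 ∧ ψ 1 = 1 := by
  have ha' : ∀ n, (a n : ℂ) ≠ 0 := fun n => Complex.ofReal_ne_zero.mpr (ha n)
  obtain ⟨u, hu0, hu⟩ := exists_forall_add_one_eq_mul
    (c := fun k => -((a (2 * k + 1) : ℂ) / a (2 * k + 2)))
    fun k => neg_ne_zero.mpr (div_ne_zero (ha' _) (ha' _))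
  have hrec : ∀ k, (a (2 * k + 1) : ℂ) * u k + (a (2 * k + 2) : ℂ) * u (k + 1) = 0 := fun k => by
    rw [hu]
    field_simp [ha' (2 * k + 2)]
    ring
  have hnorm : ∀ k, |a (2 * k + 1)| * ‖u k‖ = |a (2 * k + 2)| * ‖u (k + 1)‖ := fun k => by
    simpa using congrArg norm (eq_neg_of_add_eq_zero_left (hrec k))
  have hdouble : Tendsto (fun k : ℤ => 2 * k) atBot atBot := by
    simpa only [mul_comm, id_eq] using tendsto_id.atBot_mul_const' (zero_lt_two' ℤ)
  have hsum : Summable fun k => ‖u k‖ ^ 2 := by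
    refine summable_norm_sq_of_ratio hr0 hr ?_ ?_
    · filter_upwards [(tendsto_atBot_add_const_right _ 1 hdouble).eventually hbot] with k hk
      exact norm_le_mul_norm_of_abs_mul_norm_eq (ha _) (hnorm k)
        (by simpa [add_assoc] using (hk (odd_two_mul_add_one k)).2)
    · filter_upwards [(tendsto_atTop_add_const_right _ 2
        (tendsto_id.const_mul_atTop' (zero_lt_two' ℤ))).eventually htop] with k hk
      exact norm_le_mul_norm_of_abs_mul_norm_eq (ha _) (hnorm k).symm
        (by simpa [add_sub_assoc] using (hk ((even_two_mul k).add even_two)).1)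
  rw [← hu0]
  exact exists_hop_eq_zero_of_recurrence hsum hrec

end ZeroMode

/-! ### Stability of the spectrum -/

section Stability

theorem norm_hop_le (a : Seq) : ‖hop a‖ ≤ 2 * ‖a‖ :=
  LinearMap.mkContinuous_norm_le _ (by positivity) _

theorem hop_add (a b : Seq) : hop (a + b) = hop a + hop b := by
  ext ψ n
  change hop (a + b) ψ n = hop a ψ n + hop b ψ n
  simp only [hop_apply, lp.coeFn_add, Pi.add_apply]
  push_cast
  ring

theorem hop_ne_zero {a : Seq} (ha : a 0 ≠ 0) : hop a ≠ 0 := fun h => by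
  have := congr_arg (fun A : Hil →L[ℂ] Hil => A (lp.single 2 1 (1 : ℂ)) 0) h
  simp [hop_apply, ha] at this

theorem mem_even_add_one_iff (n : ℤ) : n + 1 ∈ {n : ℤ | Even n} ↔ n ∉ {n : ℤ | Even n} :=
  Int.even_add_one

variable {t h : Seq} {c : ℝ} {S : Set ℤ}

theorem half_mul_norm_siteProj_le (ht : ∀ ψ, c * ‖siteProj S ψ‖ ≤ ‖hop t (siteProj S ψ)‖)
    (hh : ‖h‖ ≤ c / 4) (ψ : Hil) :
    c / 2 * ‖siteProj S ψ‖ ≤ ‖hop (t + h) (siteProj S ψ)‖ := by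
  rw [hop_add]
  refine le_trans ?_ (sub_norm_mul_le_norm_add_apply (ht ψ))
  gcongr
  linarith [norm_hop_le h]

theorem apply_zero_eq_zero_of_hop_eq_zero (hc : 0 < c)
    (h_even : ∀ ψ, c * ‖siteProj {n | Even n} ψ‖ ≤ ‖hop t (siteProj {n | Even n} ψ)‖) {ψ : Hil}
    (hψ : hop t ψ = 0) : ψ 0 = 0 := by
  have hP : hop t (siteProj {n | Even n} ψ) = 0 := by
    have := DFunLike.congr_fun (hop_mul_siteProj t mem_even_add_one_iff) ψ
    simpa [hψ] using this
  have hPψ : siteProj {n | Even n} ψ = 0 := by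
    have := h_even ψ
    rw [hP, norm_zero] at this
    exact norm_le_zero_iff.mp (nonpos_of_mul_nonpos_right this hc)
  rw [← siteProj_apply_of_mem (S := {n | Even n}) ψ Even.zero, hPψ]
  rfl

theorem le_norm_of_mem_spectrum_hop_add
    (h_even : ∀ ψ, c * ‖siteProj {n | Even n} ψ‖ ≤ ‖hop t (siteProj {n | Even n} ψ)‖)
    (hh : ‖h‖ ≤ c / 4) {z : ℂ} (hz : z ∈ spectrum ℂ (hop t + hop h)) (hz0 : z ≠ 0) :
    c / 2 ≤ ‖z‖ :=
  le_norm_of_mem_spectrum_of_chiral (isSelfAdjoint_hop (t + h))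
    (hop_mul_siteProj _ mem_even_add_one_iff) (half_mul_norm_siteProj_le h_even hh)
    (hop_add t h ▸ hz) hz0

variable {W δ τ : ℝ}

theorem IsHomoclinic.exists_spectral_gap (ht : IsHomoclinic W δ t) (hδ : 0 < δ) (hδW : δ < W)
    (hτ : 0 < τ) (htτ : ∀ n, τ ≤ |t n|) :
    ∃ c > 0, ∃ η > 0, ∀ h : Seq, ‖h‖ ≤ η →
      (∀ x ∈ spectrum ℂ (hop t + hop h), x ≠ 0 → c ≤ ‖x‖) ∧
        0 ∉ spectrum ℂ (hop t + hop h) := by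
  have hr0 : 0 < (W - δ / 2) / (W + δ / 2) := div_pos (by linarith) (by linarith)
  have hr : (W - δ / 2) / (W + δ / 2) < 1 := (div_lt_one (by linarith)).mpr (by linarith)
  have hdom : DominatesAlong t ((W - δ / 2) / (W + δ / 2)) Even cofinite := by
    simpa only [add_zero] using ht.dominatesAlong hδW (h := 0) (by simpa using hδ)
  obtain ⟨c, hc, h_even⟩ := exists_mul_norm_even_le_of_cofinite hτ htτ hr0 hr hdom
  obtain ⟨d, hd, h_odd⟩ := exists_mul_norm_odd_le_of_cofinite hτ htτ hr0 hr hdom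
  have hmin : 0 < min c d := lt_min hc hd
  replace h_even ψ := (mul_le_mul_of_nonneg_right (min_le_left c d) (norm_nonneg _)).trans
    (h_even ψ)
  replace h_odd ψ := (mul_le_mul_of_nonneg_right (min_le_right c d) (norm_nonneg _)).trans
    (h_odd ψ)
  refine ⟨min c d / 2, half_pos hmin, min c d / 4, by positivity, fun h hh =>
    ⟨fun x => le_norm_of_mem_spectrum_hop_add h_even hh, (spectrum.zero_notMem_iff ℂ).mpr ?_⟩⟩
  rw [← hop_add]
  refine isUnit_of_chiral (isSelfAdjoint_hop _).isStarNormal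
    (hop_mul_siteProj _ mem_even_add_one_iff) (half_pos hmin)
    (half_mul_norm_siteProj_le h_even hh) ?_
  rw [one_sub_siteProj]
  exact half_mul_norm_siteProj_le h_odd hh

theorem IsHeteroclinic.exists_spectral_gap (ht : IsHeteroclinic W δ t) (hδ : 0 < δ) (hδW : δ < W)
    (hτ : 0 < τ) (htτ : ∀ n, τ ≤ |t n|) :
    ∃ c > 0, ∃ η > 0, ∀ h : Seq, ‖h‖ ≤ η →
      (∀ x ∈ spectrum ℂ (hop t + hop h), x ≠ 0 → c ≤ ‖x‖) ∧
        IsSimpleIsolatedEigenvalue (hop t + hop h) 0 := by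
  have hr0 : 0 < (W - δ / 2) / (W + δ / 2) := div_pos (by linarith) (by linarith)
  have hr : (W - δ / 2) / (W + δ / 2) < 1 := (div_lt_one (by linarith)).mpr (by linarith)
  have h_zero : ‖(0 : Seq)‖ < δ / 2 := by simpa using hδ
  obtain ⟨c, hc, h_even⟩ := exists_mul_norm_even_le_of_atBot_atTop hτ htτ hr0 hr
    (by simpa only [add_zero] using ht.dominatesAlong_atBot hδW h_zero)
    (by simpa only [add_zero] using ht.dominatesAlong_atTop hδW h_zero)
  refine ⟨c / 2, half_pos hc, min (c / 4) (min (τ / 2) (δ / 4)), by positivity, fun h hh => ?_⟩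
  obtain ⟨hhc, hhτ, hhδ⟩ := (le_min_iff.trans (and_congr_right' le_min_iff)).mp hh
  have hne : ∀ n, (t + h) n ≠ 0 := fun n hn => by
    have hhn : |h n| ≤ ‖h‖ := lp.norm_apply_le_norm (by simp) h n
    rw [lp.coeFn_add, Pi.add_apply] at hn
    have := htτ n
    rw [eq_neg_of_add_eq_zero_left hn, abs_neg] at this
    linarith
  have hhδ' : ‖h‖ < δ / 2 := by linarith
  obtain ⟨φ, hφ, hφ1⟩ := exists_hop_eq_zero_of_dominatesAlong hne hr0.le hr
    (ht.dominatesAlong_atBot hδW hhδ') (ht.dominatesAlong_atTop hδW hhδ')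
  have h_gap : ∀ x ∈ spectrum ℂ (hop t + hop h), x ≠ 0 → c / 2 ≤ ‖x‖ := fun x =>
    le_norm_of_mem_spectrum_hop_add h_even hhc
  refine ⟨h_gap, isSimpleIsolatedEigenvalue_of_le_norm_sub (half_pos hc) ?_
    (by simpa only [sub_zero] using h_gap)⟩
  rw [← hop_add]
  exact finrank_eigenspace_hop hne (fun ψ => apply_zero_eq_zero_of_hop_eq_zero (half_pos hc)
    (half_mul_norm_siteProj_le h_even hhc)) hφ hφ1

theorem exists_spectral_gap_of_isHomoclinic_or_isHeteroclinic
    (ht : IsHomoclinic W δ t ∨ IsHeteroclinic W δ t) (hδ : 0 < δ) (hδW : δ < W)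
    (ht0 : ∀ n, t n ≠ 0) :
    ∃ c > 0, ∃ η > 0, ∀ h : Seq, ‖h‖ ≤ η →
      (∀ x ∈ spectrum ℂ (hop t + hop h), x ≠ 0 → c ≤ ‖x‖) ∧
        (IsHomoclinic W δ t → 0 ∉ spectrum ℂ (hop t + hop h)) ∧
        (IsHeteroclinic W δ t → IsSimpleIsolatedEigenvalue (hop t + hop h) 0) := by
  obtain ⟨τ, hτ, htτ⟩ := exists_pos_forall_le_abs ht0 (half_pos (sub_pos.mpr hδW))
    (eventually_cofinite_le_abs hδ.le hδW ht)
  rcases ht with ht | ht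
  · obtain ⟨c, hc, η, hη, H⟩ := ht.exists_spectral_gap hδ hδW hτ htτ
    exact ⟨c, hc, η, hη, fun h hh => ⟨(H h hh).1, fun _ => (H h hh).2,
      fun ht' => absurd ht' (ht.not_isHeteroclinic hδ)⟩⟩
  · obtain ⟨c, hc, η, hη, H⟩ := ht.exists_spectral_gap hδ hδW hτ htτ
    exact ⟨c, hc, η, hη, fun h hh => ⟨(H h hh).1,
      fun ht' => absurd ht (ht'.not_isHeteroclinic hδ), fun _ => (H h hh).2⟩⟩

end Stability

end SSH

end

theorem mainTheorem4_general (W δ : ℝ) (hδ : 0 < δ) (hδW : δ < W)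
    (t : SSH.Seq) (ht : SSH.IsHomoclinic W δ t ∨ SSH.IsHeteroclinic W δ t)
    (ht0 : ∀ n, t n ≠ 0) :
    0 < SSH.gap (SSH.hop t) ∧
    ∃ l : ℝ, l < -(SSH.gap (SSH.hop t)) / 2 ∧ ∃ C : ℝ, 0 ≤ C ∧ ∃ η : ℝ, 0 < η ∧
      ∀ h : SSH.Seq, ‖h‖ ≤ η →
        (∀ z ∈ Set.range (SSH.contour l (-(SSH.gap (SSH.hop t)) / 2)),
          IsUnit (algebraMap ℂ (SSH.Hil →L[ℂ] SSH.Hil) z - (SSH.hop t + SSH.hop h)) ∧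
            ‖resolvent (SSH.hop t + SSH.hop h) z‖ ≤ C) ∧
        -SSH.negativePart (SSH.hop t + SSH.hop h) =
          (1 / (2 * (Real.pi : ℂ) * Complex.I)) •
            SSH.lineIntegral (SSH.contour l (-(SSH.gap (SSH.hop t)) / 2))
              (fun z => z • resolvent (SSH.hop t + SSH.hop h) z) ∧
        (SSH.IsHomoclinic W δ t → (0 : ℂ) ∉ spectrum ℂ (SSH.hop t + SSH.hop h)) ∧
        (SSH.IsHeteroclinic W δ t →
          SSH.IsSimpleIsolatedEigenvalue (SSH.hop t + SSH.hop h) 0) := by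
  obtain ⟨c, hc, η₁, hη₁, h_spec⟩ :=
    SSH.exists_spectral_gap_of_isHomoclinic_or_isHeteroclinic ht hδ hδW ht0
  have h_gap : 0 < SSH.gap (SSH.hop t) := by
    have h_zero := (h_spec 0 (norm_zero.trans_le hη₁.le)).1
    rw [← SSH.hop_add, add_zero] at h_zero
    exact hc.trans_le (SSH.le_gap (SSH.isSelfAdjoint_hop t).isStarNormal
      (SSH.hop_ne_zero (ht0 0)) h_zero)
  obtain ⟨l, hl, C, hC, η₂, hη₂, h_contour⟩ :=
    SSH.exists_contour_neg_negativePart_add (SSH.isSelfAdjoint_hop t) h_gap hc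
  refine ⟨h_gap, l, hl, C, hC, min η₁ (η₂ / 2), by positivity, fun h hh => ?_⟩
  obtain ⟨h_away, h_zero⟩ := h_spec h (hh.trans (min_le_left _ _))
  have h_norm : ‖SSH.hop h‖ ≤ η₂ := by
    linarith [SSH.norm_hop_le h, hh.trans (min_le_right _ _)]
  obtain ⟨h_res, h_int⟩ := h_contour _ (SSH.isSelfAdjoint_hop h) h_norm h_away
  exact ⟨h_res, h_int, h_zero⟩

theorem mainTheorem4 (W δ : ℝ) (hδ : 0 < δ) (hδW : δ < W)
    (t : SSH.Seq) (ht : SSH.IsHomoclinic W δ t ∨ SSH.IsHeteroclinic W δ t)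
    (τ : ℝ) (hτ : 0 < τ) (htτ : ∀ n, τ ≤ t n) :
    0 < SSH.gap (SSH.hop t) ∧
    ∃ l : ℝ, l < -(SSH.gap (SSH.hop t)) / 2 ∧ ∃ C : ℝ, 0 ≤ C ∧ ∃ η : ℝ, 0 < η ∧
      ∀ h : SSH.Seq, ‖h‖ ≤ η →
        (∀ z ∈ Set.range (SSH.contour l (-(SSH.gap (SSH.hop t)) / 2)),
          IsUnit (algebraMap ℂ (SSH.Hil →L[ℂ] SSH.Hil) z - (SSH.hop t + SSH.hop h)) ∧
            ‖resolvent (SSH.hop t + SSH.hop h) z‖ ≤ C) ∧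
        -SSH.negativePart (SSH.hop t + SSH.hop h) =
          (1 / (2 * (Real.pi : ℂ) * Complex.I)) •
            SSH.lineIntegral (SSH.contour l (-(SSH.gap (SSH.hop t)) / 2))
              (fun z => z • resolvent (SSH.hop t + SSH.hop h) z) ∧
        (SSH.IsHomoclinic W δ t → (0 : ℂ) ∉ spectrum ℂ (SSH.hop t + SSH.hop h)) ∧
        (SSH.IsHeteroclinic W δ t →
          SSH.IsSimpleIsolatedEigenvalue (SSH.hop t + SSH.hop h) 0) :=
  mainTheorem4_general W δ hδ hδW t ht fun n => (hτ.trans_le (htτ n)).ne'
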